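/- Let $\boldsymbol\Sigma\in\mathbb R^{p\times p}$ be positive semidefinite and let $\mathbf Z\in\mathbb R^{n\times p}$ be a random matrix with i.i.d. $\mathcal N_p(0,\boldsymbol\Sigma)$ rows. For a compact set $\mathcal B\subset\mathbb R^m$ let $\mathscr G(\mathcal B)=\mathbb E\big[\sup_{b\in\mathcal B}b^\top\xi\big]$, $\xi\sim\mathcal N_m(0,\mathbf I_m)$, denote its Gaussian width, and let $\mathbb B_q^m$ be the closed unit ball of the $\ell_q$-norm in $\mathbb R^m$. Suppose that $\delta\in(0,1/7]$, $n\ge 100$ and $\alpha>0$ are such that $$1-\frac{4.3+\sqrt{2\log(9/\delta)}}{\sqrt n}>0$$ and $$C_{n,\delta}:=\Big(1-\frac{4.3+\sqrt{2\log(9/\delta)}}{\sqrt n}\Big)^2-\sqrt{\frac2n}\,\big(4.8+\sqrt{\log(81/\delta)}\big)-\alpha^2>0 .$$ Then, with probability at least $1-2\delta$, the following holds simultaneously for all $v\in\mathbb R^p$ and $u\in\mathbb R^n$: $$\Big\|\frac{1}{\sqrt n}\mathbf Z v+u\Big\|_2\ \ge\ C_{n,\delta}^{1/2}\,\big\|[\boldsymbol\Sigma^{1/2}v;u]\big\|_2-1.2\Big(1+\frac1\alpha\Big)\frac{\mathscr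 G(\boldsymbol\Sigma^{1/2}\mathbb B_1^p)}{\sqrt n}\|v\|_1-\frac{1.2}{\alpha}\,\frac{\mathscr G(\|u\|_1\mathbb B_1^n\cap\|u\|_2\mathbb B_2^n)}{\sqrt n},$$ where $[\boldsymbol\Sigma^{1/2}v;u]\in\mathbb R^{p+n}$ is the concatenation of the two vectors. -/

import Mathlib

open MeasureTheory ProbabilityTheory
open scoped Pointwise

noncomputable section

/-- The `ℓ₁`-norm of a vector of `ℝᵐ`. (On `EuclideanSpace` the norm `‖·‖` is the `ℓ₂`-norm.) -/
def l1norm {m : ℕ} (x : EuclideanSpace ℝ (Fin m)) : ℝ := ∑ i, |x i|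

/-- The closed unit ball of the `ℓ₁`-norm in `ℝᵐ`. -/
def l1Ball (m : ℕ) : Set (EuclideanSpace ℝ (Fin m)) := {x | l1norm x ≤ 1}

/-- The closed unit ball of the `ℓ₂`-norm in `ℝᵐ`. -/
def l2Ball (m : ℕ) : Set (EuclideanSpace ℝ (Fin m)) := Metric.closedBall 0 1

/-- The Gaussian width `E[sup_{b ∈ B} bᵀξ]` of a (nonempty compact) set `B ⊆ ℝᵐ`, where `ξ` has
i.i.d. standard normal coordinates. -/
def gaussianWidth {m : ℕ} (B : Set (EuclideanSpace ℝ (Fin m))) : ℝ :=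
  ∫ ξ, sSup ((fun b => inner ℝ b ξ) '' B) ∂(stdGaussian (EuclideanSpace ℝ (Fin m)))

open scoped MatrixOrder Matrix.Norms.L2Operator in
/-- The linear map of `ℝᵖ` given by the positive semidefinite square root of the matrix `S`. -/
def sqrtCov {p : ℕ} (S : Matrix (Fin p) (Fin p) ℝ) :
    EuclideanSpace ℝ (Fin p) →L[ℝ] EuclideanSpace ℝ (Fin p) :=
  Matrix.toEuclideanCLM (𝕜 := ℝ) (CFC.sqrt S)

/-- `Z` is a random `n × p` matrix whose rows are i.i.d. with law `N_p(0, S)`. -/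
structure IsGaussianDesign {Ω : Type*} [MeasurableSpace Ω] {n p : ℕ}
    (Z : Ω → Matrix (Fin n) (Fin p) ℝ) (S : Matrix (Fin p) (Fin p) ℝ) (P : Measure Ω) : Prop where
  indep : iIndepFun (fun (i : Fin n) (ω : Ω) => WithLp.toLp 2 (Z ω i)) P
  law : ∀ i : Fin n, HasLaw (fun ω : Ω => WithLp.toLp 2 (Z ω i)) (multivariateGaussian 0 S) P

/-- The normalized design `Z⁽ⁿ⁾ = Z / √n` applied to a vector `v`. -/
def normDesign {n p : ℕ} (Z : Matrix (Fin n) (Fin p) ℝ) (v : EuclideanSpace ℝ (Fin p)) :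
    EuclideanSpace ℝ (Fin n) :=
  WithLp.toLp 2 (((1 / √(n : ℝ)) • Z).mulVec v.ofLp)

/-- `1 - (4.3 + √(2 log(9/δ))) / √n`. -/
def tpConst (n : ℕ) (δ : ℝ) : ℝ :=
  1 - (4.3 + √(2 * Real.log (9 / δ))) / √(n : ℝ)

/-- `C_{n,δ}`, which also depends on `α`. -/
def atpConst (n : ℕ) (δ α : ℝ) : ℝ :=
  tpConst n δ ^ 2 - √(2 / (n : ℝ)) * (4.8 + √(Real.log (81 / δ))) - α ^ 2

end

/-! In law, Z = G Σ^{1/2} with G a standard Gaussian matrix, so with w = Σ^{1/2} v the claim is a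
lower bound on ‖G w + √n u‖ uniform in the pair. Both sides are homogeneous, so ‖w‖² + ‖u‖² = 1 may
be assumed, and a dense sequence, exhausted by finite families, stands for all pairs. This reduces
everything to `measureReal_rowAct_lt_le`.

There, Gordon's comparison `rowAct_lt_le_two_mul` trades ‖G w + √n u‖ for ‖‖w‖ g + √n u‖ + ⟨w, h⟩
with independent Gaussian vectors g and h. When g and h are typical, the latter exceeds the target
by the margin T = 2√log(9/δ) (`transferBound_add_le`). Typicality combines a chi-square tail for
‖g‖², a peeling bound for ⟨u, g⟩ in terms of the width of the cross ball of u, and Markov's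
inequality for the support function at h. It fails with probability at most 17/36. Since Gordon's
step costs a factor 2, the raised bound holds for G with probability at least 1/18. The two-copy
concentration inequality P(some < c − T) · P(all ≥ c) ≤ exp(−T²/4) = δ/9 then gives failure
probability at most 2δ for the bound without the margin. Thus the decoupled problem only has to be
solved with constant probability.

Gordon's comparison and the concentration both come from `SecondJet.integral_le_exp_mul`: if half
the difference of the second-order terms of f under two centered Gaussian laws is at most κ f, the
averages differ by a factor of at most exp κ. Its proof cuts both covariances into m equal pieces
and exchanges them one at a time, each at a cost O(m^{-3/2}). Only Taylor bounds uniform in the base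
point are needed, a property stable under sums, affine substitutions and suitable scalar
compositions. For Gordon, f is the exponential of a sum of steep arctangents; for concentration,
f(x, y) = exp(t(F(x) − F(y))), and an independent pair is compared with the diagonal pair (x, x),
where f = 1. -/

set_option linter.unusedSectionVars false

/-! ### Functions with uniform second-order Taylor bounds -/

section SecondJet

variable {E : Type*} [NormedAddCommGroup E] [NormedSpace ℝ E]

/-- `f` has first and second order parts `D`, `Q` with Taylor bounds that are uniform in the base
point. -/
structure SecondJet (f : E → ℝ) (D : E → E →L[ℝ] ℝ) (Q : E → E → ℝ) (C : ℝ) : Prop where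
  nonneg : 0 ≤ C
  bound1 : ∀ x y, |D x y| ≤ C * ‖y‖
  bound2 : ∀ x y, |Q x y| ≤ C * ‖y‖ ^ 2
  rem0 : ∀ x y, |f (x + y) - f x| ≤ C * ‖y‖
  rem1 : ∀ x y, |f (x + y) - f x - D x y| ≤ C * ‖y‖ ^ 2
  rem2 : ∀ x y, |f (x + y) - f x - D x y - 1 / 2 * Q x y| ≤ C * ‖y‖ ^ 3
  continuous_quad : ∀ x, Continuous (Q x)
  quad_smul : ∀ x (c : ℝ) y, Q x (c • y) = c ^ 2 * Q x y

theorem SecondJet.continuous {f : E → ℝ} {D : E → E →L[ℝ] ℝ} {Q : E → E → ℝ} {C : ℝ}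
    (h : SecondJet f D Q C) : Continuous f := by
  have : LipschitzWith C.toNNReal f := by
    refine LipschitzWith.of_dist_le_mul fun x y => ?_
    rw [Real.dist_eq, dist_eq_norm, Real.coe_toNNReal _ h.nonneg]
    simpa using h.rem0 y (x - y)
  exact this.continuous

end SecondJet

/-! ### Centered Gaussian measures and the comparison principle -/

section Centered

variable {E : Type*} [NormedAddCommGroup E] [NormedSpace ℝ E] [CompleteSpace E]
  [MeasurableSpace E] [BorelSpace E] [SecondCountableTopology E]

/-- All continuous linear functionals have mean zero. -/
def IsCentered {E : Type*} [NormedAddCommGroup E] [NormedSpace ℝ E] [MeasurableSpace E]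
    (μ : Measure E) : Prop := ∀ L : StrongDual ℝ E, ∫ x, L x ∂μ = 0

/-- Centered Gaussian measures are determined by the second moments of functionals. -/
theorem IsCentered.ext {μ ν : Measure E} [IsGaussian μ] [IsGaussian ν]
    (hμ : IsCentered μ) (hν : IsCentered ν)
    (h : ∀ L : StrongDual ℝ E, ∫ x, (L x) ^ 2 ∂μ = ∫ x, (L x) ^ 2 ∂ν) : μ = ν := by
  refine Measure.ext_of_charFunDual ?_
  ext L
  rw [IsGaussian.charFunDual_eq_of_forall_strongDual_eq_zero hμ,
    IsGaussian.charFunDual_eq_of_forall_strongDual_eq_zero hν,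
    variance_of_integral_eq_zero (by fun_prop) (hμ L),
    variance_of_integral_eq_zero (by fun_prop) (hν L), h L]

theorem IsCentered.map {F : Type*} [NormedAddCommGroup F] [NormedSpace ℝ F]
    [MeasurableSpace F] [BorelSpace F] {μ : Measure E} (hμ : IsCentered μ)
    (A : E →L[ℝ] F) : IsCentered (μ.map A) := by
  intro L
  rw [integral_map (by fun_prop) (by fun_prop)]
  exact hμ (L.comp A)

theorem isCentered_stdGaussian {E : Type*} [NormedAddCommGroup E] [InnerProductSpace ℝ E]
    [FiniteDimensional ℝ E] [MeasurableSpace E] [BorelSpace E] :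
    IsCentered (stdGaussian E) := fun L => integral_strongDual_stdGaussian L

theorem IsCentered.prod {F : Type*} [NormedAddCommGroup F] [NormedSpace ℝ F]
    [MeasurableSpace F] [BorelSpace F] [SecondCountableTopology F]
    {μ : Measure E} {ν : Measure F} [IsGaussian μ] [IsGaussian ν]
    (hμ : IsCentered μ) (hν : IsCentered ν) : IsCentered (μ.prod ν) := by
  intro L
  rw [integral_continuousLinearMap_prod' (IsGaussian.integrable_dual μ _)
    (IsGaussian.integrable_dual ν _), hμ, hν, add_zero]

theorem integral_sq_prod {F : Type*} [NormedAddCommGroup F] [NormedSpace ℝ F]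
    [MeasurableSpace F] [BorelSpace F] [SecondCountableTopology F] [CompleteSpace F]
    {μ : Measure E} {ν : Measure F} [IsGaussian μ] [IsGaussian ν]
    (hμ : IsCentered μ) (hν : IsCentered ν) (L : StrongDual ℝ (E × F)) :
    ∫ z, (L z) ^ 2 ∂(μ.prod ν) =
      ∫ x, (L (x, 0)) ^ 2 ∂μ + ∫ y, (L (0, y)) ^ 2 ∂ν := by
  have h := variance_dual_prod' (L := L) (IsGaussian.memLp_dual μ (L.comp (.inl ℝ E F)) 2 (by simp))
      (IsGaussian.memLp_dual ν (L.comp (.inr ℝ E F)) 2 (by simp))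
  rw [variance_of_integral_eq_zero (by fun_prop) (hμ.prod hν L),
    variance_of_integral_eq_zero (by fun_prop) (hμ _),
    variance_of_integral_eq_zero (by fun_prop) (hν _)] at h
  simpa using h

/-- `μ` rescaled to have its covariance multiplied by `s`. -/
noncomputable def covScale (μ : Measure E) (s : ℝ) : Measure E :=
  μ.map (Real.sqrt s • ContinuousLinearMap.id ℝ E)

instance (μ : Measure E) [IsGaussian μ] (s : ℝ) : IsGaussian (covScale μ s) := by
  unfold covScale; infer_instance

theorem integral_covScale (μ : Measure E) (s : ℝ) {f : E → ℝ} (hf : Continuous f) :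
    ∫ x, f x ∂(covScale μ s) = ∫ x, f (Real.sqrt s • x) ∂μ := by
  unfold covScale
  rw [integral_map (by fun_prop) hf.aestronglyMeasurable]
  rfl

theorem IsCentered.covScale {μ : Measure E} (hμ : IsCentered μ) (s : ℝ) :
    IsCentered (covScale μ s) := hμ.map _

theorem covScale_one (μ : Measure E) : covScale μ 1 = μ := by
  simp [covScale]

theorem covScale_zero (μ : Measure E) [IsProbabilityMeasure μ] :
    covScale μ 0 = Measure.dirac 0 := by
  have : ((Real.sqrt 0 • ContinuousLinearMap.id ℝ E : E →L[ℝ] E) : E → E) = fun _ => 0 := by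
    ext; simp
  rw [covScale, this]
  simp

/-- The variance of every functional is linear in the scale. This semigroup property is what allows
a Gaussian law to be cut into m equal independent pieces. -/
theorem covScale_add {μ : Measure E} [IsGaussian μ] (hμ : IsCentered μ) {s t : ℝ}
    (hs : 0 ≤ s) (ht : 0 ≤ t) :
    covScale μ (s + t) = (covScale μ s).conv (covScale μ t) := by
  refine Measure.ext_of_charFunDual ?_
  ext L
  rw [charFunDual_conv]
  have key : ∀ r : ℝ, 0 ≤ r → charFunDual (covScale μ r) L
      = Complex.exp (- ((r * ∫ x, (L x) ^ 2 ∂μ : ℝ) : ℂ) / 2) := by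
    intro r hr
    rw [IsGaussian.charFunDual_eq_of_forall_strongDual_eq_zero (hμ.covScale r),
      variance_of_integral_eq_zero (by fun_prop) (hμ.covScale r L),
      integral_covScale μ r (by fun_prop : Continuous fun x => (L x) ^ 2)]
    simp only [map_smul, smul_eq_mul, mul_pow, Real.sq_sqrt hr]
    rw [integral_const_mul]
  rw [key _ hs, key _ ht, key _ (add_nonneg hs ht), ← Complex.exp_add]
  congr 1
  push_cast
  ring

theorem integrable_norm_pow (μ : Measure E) [IsGaussian μ] (k : ℕ) :
    Integrable (fun x => ‖x‖ ^ k) μ := by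
  rcases Nat.eq_zero_or_pos k with rfl | hk
  · simp
  · have := (IsGaussian.memLp_id μ k (by simp)).integrable_norm_pow (by omega)
    simpa using this

variable {f : E → ℝ} {D : E → E →L[ℝ] ℝ} {Q : E → E → ℝ} {C : ℝ}

theorem SecondJet.integrable_add (h : SecondJet f D Q C) (μ : Measure E) [IsGaussian μ] (z : E)
    (t : ℝ) : Integrable (fun x => f (z + t • x)) μ := by
  have hc := h.continuous
  have h1 : Integrable (fun x => |f z| + C * (|t| * ‖x‖)) μ := by
    have := integrable_norm_pow μ 1
    simp only [pow_one] at this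
    exact (integrable_const _).add ((this.const_mul _).const_mul _)
  refine h1.mono' (by fun_prop) (Filter.Eventually.of_forall fun x => ?_)
  have h2 := h.rem0 z (t • x)
  rw [norm_smul, Real.norm_eq_abs] at h2
  rw [Real.norm_eq_abs]
  have h3 := abs_add_le (f (z + t • x) - f z) (f z)
  rw [sub_add_cancel] at h3
  linarith

theorem SecondJet.integrable (h : SecondJet f D Q C) (μ : Measure E) [IsGaussian μ] :
    Integrable f μ := by
  simpa using h.integrable_add μ 0 1

theorem SecondJet.integrable_quad (h : SecondJet f D Q C) (μ : Measure E) [IsGaussian μ] (x : E) :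
    Integrable (Q x) μ :=
  ((integrable_norm_pow μ 2).const_mul C).mono' (h.continuous_quad x).aestronglyMeasurable
    (Filter.Eventually.of_forall fun y => h.bound2 x y)

/-- Small-variance expansion of a Gaussian average. -/
theorem SecondJet.abs_integral_sub_le (h : SecondJet f D Q C) {μ : Measure E} [IsGaussian μ]
    (hμ : IsCentered μ) (z : E) {t : ℝ} (ht : 0 ≤ t) :
    |∫ x, f (z + t • x) ∂μ - f z - t ^ 2 / 2 * ∫ x, Q z x ∂μ| ≤
      C * t ^ 3 * ∫ x, ‖x‖ ^ 3 ∂μ := by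
  have e : ∫ x, f (z + t • x) ∂μ - f z - t ^ 2 / 2 * ∫ x, Q z x ∂μ =
      ∫ x, (f (z + t • x) - f z - D z (t • x) - 1 / 2 * Q z (t • x)) ∂μ := by
    have i1 := h.integrable_add μ z t
    have i2 : Integrable (fun x => D z (t • x)) μ := by
      simp only [map_smul, smul_eq_mul]
      exact (IsGaussian.integrable_dual μ (D z)).const_mul t
    have i3 : Integrable (fun x => 1 / 2 * Q z (t • x)) μ := by
      simp only [h.quad_smul]
      exact ((h.integrable_quad μ z).const_mul _).const_mul _
    have i4 : Integrable (fun x => f (z + t • x) - f z) μ := i1.sub (integrable_const _)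
    have i5 : Integrable (fun x => f (z + t • x) - f z - D z (t • x)) μ := i4.sub i2
    rw [integral_sub i5 i3, integral_sub i4 i2, integral_sub i1 (integrable_const _)]
    -- The first-order term integrates to zero because `μ` is centered.
    simp only [map_smul, smul_eq_mul, h.quad_smul, integral_const_mul, hμ (D z)]
    simp
    ring
  rw [e, ← integral_const_mul]
  refine (abs_integral_le_integral_abs).trans ?_
  refine integral_mono_of_nonneg (Filter.Eventually.of_forall fun x => abs_nonneg _)
    ((integrable_norm_pow μ 3).const_mul _) (Filter.Eventually.of_forall fun x => ?_)
  have h2 := h.rem2 z (t • x)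
  rw [norm_smul, Real.norm_of_nonneg ht, mul_pow, ← mul_assoc] at h2
  exact h2

/-- Lets the error κ f(z) of one exchange be rewritten through the average around z, so that it
becomes a multiplicative factor. -/
theorem SecondJet.le_integral_add (h : SecondJet f D Q C) {μ : Measure E} [IsGaussian μ]
    (z : E) {t : ℝ} (ht : 0 ≤ t) :
    f z ≤ ∫ x, f (z + t • x) ∂μ + C * t * ∫ x, ‖x‖ ∂μ := by
  have i1 := h.integrable_add μ z t
  have i2 : Integrable (fun x : E => ‖x‖) μ := by simpa using integrable_norm_pow μ 1
  rw [← integral_const_mul, ← integral_add i1 (i2.const_mul _)]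
  have : f z = ∫ _, f z ∂μ := by simp
  rw [this]
  refine integral_mono (integrable_const _) (i1.add (i2.const_mul _)) fun x => ?_
  have h2 := h.rem0 z (t • x)
  rw [norm_smul, Real.norm_of_nonneg ht, ← mul_assoc] at h2
  have := (abs_le.1 h2).1
  simp only
  linarith

/-- The two small-variance expansions differ by t²/2 times the difference of the Q-integrals, which
is at most κ t² f(z). Replacing f(z) by its ν-average costs another term of order t³. -/
theorem SecondJet.integral_step (h : SecondJet f D Q C) {μ ν : Measure E} [IsGaussian μ]
    [IsGaussian ν] (hμ : IsCentered μ) (hν : IsCentered ν) {κ : ℝ} (hκ : 0 ≤ κ)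
    (hQ : ∀ x, ∫ y, Q x y ∂μ ≤ ∫ y, Q x y ∂ν + 2 * κ * f x) (z : E) {t : ℝ} (ht : 0 ≤ t) :
    ∫ x, f (z + t • x) ∂μ ≤ (1 + κ * t ^ 2) * ∫ x, f (z + t • x) ∂ν +
      C * (∫ x, ‖x‖ ^ 3 ∂μ + ∫ x, ‖x‖ ^ 3 ∂ν + κ * ∫ x, ‖x‖ ∂ν) * t ^ 3 := by
  have h1 := (abs_le.1 (h.abs_integral_sub_le hμ z ht)).2
  have h2 := (abs_le.1 (h.abs_integral_sub_le hν z ht)).1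
  have h3 := mul_le_mul_of_nonneg_left (h.le_integral_add (μ := ν) z ht)
    (by positivity : 0 ≤ κ * t ^ 2)
  have h4 := mul_le_mul_of_nonneg_left (hQ z) (by positivity : 0 ≤ t ^ 2 / 2)
  linarith

theorem SecondJet.integral_conv (h : SecondJet f D Q C) (ρ μ : Measure E) [IsGaussian ρ]
    [IsGaussian μ] (s : ℝ) :
    ∫ x, f x ∂(ρ.conv (covScale μ s)) = ∫ z, ∫ x, f (z + Real.sqrt s • x) ∂μ ∂ρ ∧
      Integrable (fun z => ∫ x, f (z + Real.sqrt s • x) ∂μ) ρ := by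
  have hc := h.continuous
  have hi : Integrable f (ρ.conv (covScale μ s)) := h.integrable _
  have e : ∀ z, ∫ y, f (z + y) ∂(covScale μ s) = ∫ x, f (z + Real.sqrt s • x) ∂μ := fun z =>
    integral_covScale μ s (f := fun y => f (z + y)) (by fun_prop)
  constructor
  · rw [MeasureTheory.integral_conv hi]
    simp only [e]
  · have hi' : Integrable (fun p : E × E => f (p.1 + p.2)) (ρ.prod (covScale μ s)) := by
      rw [Measure.conv] at hi
      exact hi.comp_measurable (by fun_prop)
    simpa only [e] using hi'.integral_prod_left

/-- Gaussian comparison: if the generator of `μ` applied to `f` exceeds that of `ν` by at most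
`κ f`, then the `μ`-average of `f` is at most `exp κ` times the `ν`-average. -/
theorem SecondJet.integral_le_exp_mul (h : SecondJet f D Q C) (hf : ∀ x, 0 ≤ f x)
    {μ ν : Measure E} [IsGaussian μ]
    [IsGaussian ν] (hμ : IsCentered μ) (hν : IsCentered ν) {κ : ℝ} (hκ : 0 ≤ κ)
    (hQ : ∀ x, ∫ y, Q x y ∂μ ≤ ∫ y, Q x y ∂ν + 2 * κ * f x) :
    ∫ x, f x ∂μ ≤ Real.exp κ * ∫ x, f x ∂ν := by
  set K := C * (∫ x, ‖x‖ ^ 3 ∂μ + ∫ x, ‖x‖ ^ 3 ∂ν + κ * ∫ x, ‖x‖ ∂ν) with hK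
  have hK0 : 0 ≤ K := by
    have := h.nonneg
    positivity
  have hν0 : 0 ≤ ∫ x, f x ∂ν := integral_nonneg hf
  have main : ∀ m : ℕ, 0 < m →
      ∫ x, f x ∂μ ≤ Real.exp κ * (∫ x, f x ∂ν + K * Real.sqrt (1 / m)) := by
    intro m hm
    have hm' : (0 : ℝ) < m := by exact_mod_cast hm
    set t := Real.sqrt (1 / (m : ℝ)) with ht
    have ht0 : 0 ≤ t := Real.sqrt_nonneg _
    have ht2 : t ^ 2 = 1 / m := Real.sq_sqrt (by positivity)
    -- J k is the average once k of the m pieces of ν have been exchanged for pieces of μ. Below, ρ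
    -- collects the m − 1 pieces shared by J k and J (k + 1).
    let J : ℕ → ℝ := fun k =>
      ∫ x, f x ∂((covScale μ (k / m)).conv (covScale ν ((m - k) / m)))
    have step : ∀ k < m, J (k + 1) ≤ (1 + κ * t ^ 2) * J k + K * t ^ 3 := by
      intro k hk
      have hk' : (k : ℝ) + 1 ≤ m := by exact_mod_cast hk
      have a1 : (0 : ℝ) ≤ k / m := by positivity
      have a2 : (0 : ℝ) ≤ (m - (k + 1)) / m := div_nonneg (by linarith) hm'.le
      have a3 : (0 : ℝ) ≤ 1 / m := by positivity
      set ρ := (covScale μ (k / m)).conv (covScale ν ((m - (k + 1)) / m)) with hρ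
      have r1 : (covScale μ ((k + 1 : ℕ) / m)).conv (covScale ν ((m - (k + 1 : ℕ)) / m)) =
          ρ.conv (covScale μ (1 / m)) := by
        push_cast
        rw [add_div, covScale_add hμ a1 a3, hρ, Measure.conv_assoc, Measure.conv_assoc,
          Measure.conv_comm (covScale μ (1 / m))]
      have r2 : (covScale μ (k / m)).conv (covScale ν ((m - k) / m)) =
          ρ.conv (covScale ν (1 / m)) := by
        rw [show ((m : ℝ) - k) / m = (m - (k + 1)) / m + 1 / m by ring, covScale_add hν a2 a3, hρ,
          Measure.conv_assoc]
      have c1 := h.integral_conv ρ μ (1 / m)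
      have c2 := h.integral_conv ρ ν (1 / m)
      change ∫ x, f x ∂_ ≤ _ * ∫ x, f x ∂_ + _
      rw [r1, r2, c1.1, c2.1, ← integral_const_mul]
      have : K * t ^ 3 = ∫ _, K * t ^ 3 ∂ρ := by simp
      rw [this, ← integral_add (c2.2.const_mul _) (integrable_const _)]
      exact integral_mono c1.2 ((c2.2.const_mul _).add (integrable_const _)) fun z =>
        h.integral_step hμ hν hκ hQ z ht0
    have hJ : ∀ k ≤ m, J k ≤ (1 + κ * t ^ 2) ^ k * (J 0 + k * (K * t ^ 3)) := by
      intro k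
      induction k with
      | zero => intro _; simp
      | succ k ih =>
        intro hk
        have b1 := step k (by omega)
        have b2 := mul_le_mul_of_nonneg_left (ih (by omega))
          (by positivity : 0 ≤ 1 + κ * t ^ 2)
        have b3 : K * t ^ 3 ≤ (1 + κ * t ^ 2) ^ (k + 1) * (K * t ^ 3) :=
          le_mul_of_one_le_left (by positivity)
            (one_le_pow₀ (by nlinarith [mul_nonneg hκ (sq_nonneg t)]))
        push_cast
        calc J (k + 1) ≤ (1 + κ * t ^ 2) * ((1 + κ * t ^ 2) ^ k * (J 0 + k * (K * t ^ 3)))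
              + (1 + κ * t ^ 2) ^ (k + 1) * (K * t ^ 3) := by linarith
          _ = (1 + κ * t ^ 2) ^ (k + 1) * (J 0 + (k + 1) * (K * t ^ 3)) := by ring
    have h0 : J 0 = ∫ x, f x ∂ν := by
      simp only [J]
      rw [Nat.cast_zero, zero_div, sub_zero, div_self hm'.ne', covScale_one, covScale_zero,
        Measure.dirac_zero_conv]
    have h1 : J m = ∫ x, f x ∂μ := by
      simp only [J]
      rw [sub_self, zero_div, div_self hm'.ne', covScale_one, covScale_zero,
        Measure.conv_dirac_zero]
    have := hJ m le_rfl
    rw [h0, h1] at this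
    refine this.trans ?_
    -- Since m t² = 1, the m errors of order t³ add up to order t = m^{-1/2}, which vanishes in the
    -- limit.
    have e1 : (m : ℝ) * (K * t ^ 3) = K * t := by
      rw [show (m : ℝ) * (K * t ^ 3) = m * t ^ 2 * (K * t) by ring, ht2]
      field_simp
    rw [e1]
    refine mul_le_mul_of_nonneg_right ?_ (by positivity)
    calc (1 + κ * t ^ 2) ^ m ≤ (Real.exp (κ * t ^ 2)) ^ m := by
          gcongr
          linarith [Real.add_one_le_exp (κ * t ^ 2)]
      _ = Real.exp κ := by
          rw [← Real.exp_nat_mul, ht2]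
          congr 1
          field_simp
  have lim : Filter.Tendsto
      (fun m : ℕ => Real.exp κ * (∫ x, f x ∂ν + K * Real.sqrt (1 / (m : ℝ)))) Filter.atTop
      (nhds (Real.exp κ * (∫ x, f x ∂ν + K * Real.sqrt 0))) := by
    have := (Real.continuous_sqrt.tendsto 0).comp (tendsto_one_div_atTop_nhds_zero_nat (𝕜 := ℝ))
    exact ((this.const_mul K).const_add _).const_mul _
  rw [Real.sqrt_zero, mul_zero, add_zero] at lim
  exact ge_of_tendsto lim (Filter.eventually_atTop.2 ⟨1, fun m hm => main m hm⟩)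

end Centered

/-! ### Stability of Taylor bounds under sums and compositions -/

section JetCalculus

variable {E : Type*} [NormedAddCommGroup E] [NormedSpace ℝ E]
  {F : Type*} [NormedAddCommGroup F] [NormedSpace ℝ F]

/-- `f` has a second order jet with some uniform constant. -/
def HasSecondJet (f : E → ℝ) (D : E → E →L[ℝ] ℝ) (Q : E → E → ℝ) : Prop :=
  ∃ C, SecondJet f D Q C

theorem hasSecondJet_affine (L : E →L[ℝ] ℝ) (c : ℝ) :
    HasSecondJet (fun x => L x + c) (fun _ => L) (fun _ _ => 0) := by
  refine ⟨‖L‖, norm_nonneg _, fun x y => ?_, fun x y => ?_, fun x y => ?_, fun x y => ?_,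
    fun x y => ?_, fun x => continuous_const, fun x c y => by simp⟩
  · exact L.le_opNorm y
  · simp only [abs_zero]; positivity
  · simpa using L.le_opNorm y
  · simp; positivity
  · simp; positivity

theorem HasSecondJet.add {f g : E → ℝ} {D D' : E → E →L[ℝ] ℝ} {Q Q' : E → E → ℝ}
    (h : HasSecondJet f D Q) (h' : HasSecondJet g D' Q') :
    HasSecondJet (fun x => f x + g x) (fun x => D x + D' x) (fun x y => Q x y + Q' x y) := by
  obtain ⟨C, h⟩ := h
  obtain ⟨C', h'⟩ := h'
  refine ⟨C + C', add_nonneg h.nonneg h'.nonneg, fun x y => ?_, fun x y => ?_, fun x y => ?_,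
    fun x y => ?_, fun x y => ?_, fun x => (h.continuous_quad x).add (h'.continuous_quad x),
    fun x c y => by rw [h.quad_smul, h'.quad_smul, mul_add]⟩
  · have a := abs_le.1 (h.bound1 x y)
    have b := abs_le.1 (h'.bound1 x y)
    rw [add_apply]
    exact abs_le.2 ⟨by linarith, by linarith⟩
  · have a := abs_le.1 (h.bound2 x y)
    have b := abs_le.1 (h'.bound2 x y)
    exact abs_le.2 ⟨by linarith, by linarith⟩
  · have a := abs_le.1 (h.rem0 x y)
    have b := abs_le.1 (h'.rem0 x y)
    exact abs_le.2 ⟨by linarith, by linarith⟩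
  · have a := abs_le.1 (h.rem1 x y)
    have b := abs_le.1 (h'.rem1 x y)
    rw [add_apply]
    exact abs_le.2 ⟨by linarith, by linarith⟩
  · have a := abs_le.1 (h.rem2 x y)
    have b := abs_le.1 (h'.rem2 x y)
    rw [add_apply]
    exact abs_le.2 ⟨by linarith, by linarith⟩

theorem HasSecondJet.sum {ι : Type*} (s : Finset ι) {f : ι → E → ℝ} {D : ι → E → E →L[ℝ] ℝ}
    {Q : ι → E → E → ℝ} (h : ∀ i, HasSecondJet (f i) (D i) (Q i)) :
    HasSecondJet (fun x => ∑ i ∈ s, f i x) (fun x => ∑ i ∈ s, D i x)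
      (fun x y => ∑ i ∈ s, Q i x y) := by
  classical
  induction s using Finset.induction_on with
  | empty => simpa using hasSecondJet_affine (0 : E →L[ℝ] ℝ) 0
  | insert a s ha ih =>
    simp only [Finset.sum_insert ha]
    exact (h a).add ih

theorem HasSecondJet.comp_affine {f : E → ℝ} {D : E → E →L[ℝ] ℝ} {Q : E → E → ℝ}
    (h : HasSecondJet f D Q) (A : F →L[ℝ] E) (b : E) :
    HasSecondJet (fun x => f (A x + b)) (fun x => (D (A x + b)).comp A)
      (fun x y => Q (A x + b) (A y)) := by
  obtain ⟨C, h⟩ := h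
  have hC := h.nonneg
  -- With a ≥ 1, both a and a² are at most a³, so one constant C a³ serves all orders.
  set a := 1 + ‖A‖ with ha
  have ha1 : 1 ≤ a := by rw [ha]; linarith [norm_nonneg A]
  have hA : ∀ y, ‖A y‖ ≤ a * ‖y‖ := fun y =>
    (A.le_opNorm y).trans (by rw [ha]; gcongr; linarith)
  have p1 : a ≤ a ^ 3 := le_self_pow₀ ha1 (by norm_num)
  have p2 : a ^ 2 ≤ a ^ 3 := pow_le_pow_right₀ ha1 (by norm_num)
  have b1 : ∀ y, C * ‖A y‖ ≤ C * a ^ 3 * ‖y‖ := fun y => by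
    rw [mul_assoc]; gcongr; exact (hA y).trans (by gcongr)
  have b2 : ∀ y, C * ‖A y‖ ^ 2 ≤ C * a ^ 3 * ‖y‖ ^ 2 := fun y => by
    rw [mul_assoc]; gcongr
    calc ‖A y‖ ^ 2 ≤ (a * ‖y‖) ^ 2 := by gcongr; exact hA y
      _ ≤ a ^ 3 * ‖y‖ ^ 2 := by rw [mul_pow]; gcongr
  have b3 : ∀ y, C * ‖A y‖ ^ 3 ≤ C * a ^ 3 * ‖y‖ ^ 3 := fun y => by
    rw [mul_assoc, ← mul_pow]; gcongr; exact hA y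
  have e : ∀ x y, A (x + y) + b = (A x + b) + A y := fun x y => by rw [map_add]; abel
  refine ⟨C * a ^ 3, by positivity, fun x y => ?_, fun x y => ?_, fun x y => ?_, fun x y => ?_,
    fun x y => ?_, fun x => (h.continuous_quad _).comp A.continuous,
    fun x c y => by rw [map_smul, h.quad_smul]⟩
  · exact (h.bound1 _ _).trans (b1 y)
  · exact (h.bound2 _ _).trans (b2 y)
  · rw [e]; exact (h.rem0 _ _).trans (b1 y)
  · rw [e]; exact (h.rem1 _ _).trans (b2 y)
  · rw [e]; exact (h.rem2 _ _).trans (b3 y)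

/-- Uniform second order Taylor bounds for a function on a set of reals. -/
structure ScalarJet (I : Set ℝ) (ψ ψ₁ ψ₂ : ℝ → ℝ) (K : ℝ) : Prop where
  nonneg : 0 ≤ K
  bound1 : ∀ a ∈ I, |ψ₁ a| ≤ K
  bound2 : ∀ a ∈ I, |ψ₂ a| ≤ K
  rem0 : ∀ a ∈ I, ∀ b ∈ I, |ψ b - ψ a| ≤ K * |b - a|
  rem1 : ∀ a ∈ I, ∀ b ∈ I, |ψ b - ψ a - ψ₁ a * (b - a)| ≤ K * |b - a| ^ 2
  rem2 : ∀ a ∈ I, ∀ b ∈ I,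
    |ψ b - ψ a - ψ₁ a * (b - a) - 1 / 2 * ψ₂ a * (b - a) ^ 2| ≤ K * |b - a| ^ 3

/-- The derivative of a Taylor remainder is the remainder of one order less for the derivative, so
the mean value inequality is iterated. -/
theorem ScalarJet.of_hasDerivAt {I : Set ℝ} (hI : I.OrdConnected) {ψ ψ₁ ψ₂ ψ₃ : ℝ → ℝ} {K : ℝ}
    (hK : 0 ≤ K) (h0 : ∀ a ∈ I, HasDerivAt ψ (ψ₁ a) a) (h1 : ∀ a ∈ I, HasDerivAt ψ₁ (ψ₂ a) a)
    (h2 : ∀ a ∈ I, HasDerivAt ψ₂ (ψ₃ a) a) (b1 : ∀ a ∈ I, |ψ₁ a| ≤ K)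
    (b2 : ∀ a ∈ I, |ψ₂ a| ≤ K) (b3 : ∀ a ∈ I, |ψ₃ a| ≤ K) : ScalarJet I ψ ψ₁ ψ₂ K := by
  have mv : ∀ (g g' : ℝ → ℝ) (B : ℝ), ∀ a ∈ I, ∀ b ∈ I,
      (∀ t ∈ Set.uIcc a b, HasDerivAt g (g' t) t) → (∀ t ∈ Set.uIcc a b, |g' t| ≤ B) →
      |g b - g a| ≤ B * |b - a| := by
    intro g g' B a ha b hb hd hB
    have := (convex_uIcc a b).norm_image_sub_le_of_norm_hasDerivWithin_le (f := g) (f' := g')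
      (C := B) (fun t ht => (hd t ht).hasDerivWithinAt) hB Set.left_mem_uIcc Set.right_mem_uIcc
    simpa only [Real.norm_eq_abs] using this
  have sub : ∀ a ∈ I, ∀ b ∈ I, ∀ t ∈ Set.uIcc a b, t ∈ I := fun a ha b hb t ht =>
    hI.uIcc_subset ha hb ht
  have dist : ∀ a b t : ℝ, t ∈ Set.uIcc a b → |t - a| ≤ |b - a| := fun a b t ht =>
    Set.abs_sub_left_of_mem_uIcc ht
  have r1 : ∀ (f f₁ f₂ : ℝ → ℝ), (∀ a ∈ I, HasDerivAt f (f₁ a) a) →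
      (∀ a ∈ I, HasDerivAt f₁ (f₂ a) a) → (∀ a ∈ I, |f₂ a| ≤ K) →
      ∀ a ∈ I, ∀ b ∈ I, |f b - f a - f₁ a * (b - a)| ≤ K * |b - a| ^ 2 := by
    intro f f₁ f₂ d0 d1 c2 a ha b hb
    have := mv (fun t => f t - f₁ a * (t - a)) (fun t => f₁ t - f₁ a) (K * |b - a|) a ha b hb
      (fun t ht => by
        have := (d0 t (sub a ha b hb t ht)).fun_sub
          (((hasDerivAt_id' t).sub_const a).const_mul (f₁ a))
        simpa only [mul_one] using this)
      (fun t ht => by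
        have htI := sub a ha b hb t ht
        exact (mv f₁ f₂ K a ha t htI (fun s hs => d1 s (sub a ha t htI s hs))
          (fun s hs => c2 s (sub a ha t htI s hs))).trans
          (mul_le_mul_of_nonneg_left (dist a b t ht) hK))
    have e : f b - f a - f₁ a * (b - a) = (f b - f₁ a * (b - a)) - (f a - f₁ a * (a - a)) := by
      ring
    rw [e]
    refine this.trans (le_of_eq ?_)
    ring
  refine ⟨hK, b1, b2, fun a ha b hb => ?_, r1 ψ ψ₁ ψ₂ h0 h1 b2, fun a ha b hb => ?_⟩
  · exact mv ψ ψ₁ K a ha b hb (fun t ht => h0 t (sub a ha b hb t ht))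
      (fun t ht => b1 t (sub a ha b hb t ht))
  · have := mv (fun t => ψ t - ψ₁ a * (t - a) - 1 / 2 * ψ₂ a * (t - a) ^ 2)
      (fun t => ψ₁ t - ψ₁ a - ψ₂ a * (t - a)) (K * |b - a| ^ 2) a ha b hb
      (fun t ht => by
        have d1 := ((hasDerivAt_id' t).sub_const a)
        have := ((h0 t (sub a ha b hb t ht)).fun_sub (d1.const_mul (ψ₁ a))).fun_sub
          ((d1.fun_pow 2).const_mul (1 / 2 * ψ₂ a))
        refine this.congr_deriv ?_
        simp
        ring)
      (fun t ht => by
        have htI := sub a ha b hb t ht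
        exact (r1 ψ₁ ψ₂ ψ₃ h1 h2 b3 a ha t htI).trans (mul_le_mul_of_nonneg_left
          (pow_le_pow_left₀ (abs_nonneg _) (dist a b t ht) 2) hK))
    have e : ψ b - ψ a - ψ₁ a * (b - a) - 1 / 2 * ψ₂ a * (b - a) ^ 2 =
        (ψ b - ψ₁ a * (b - a) - 1 / 2 * ψ₂ a * (b - a) ^ 2) -
        (ψ a - ψ₁ a * (a - a) - 1 / 2 * ψ₂ a * (a - a) ^ 2) := by ring
    rw [e]
    refine this.trans (le_of_eq ?_)
    ring

/-- Second-order chain rule. Bounds on ψ are required only on a set containing the range of f, so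
that exp and log are admissible where f stays below a cap or above a positive floor. -/
theorem HasSecondJet.scalar_comp {f : E → ℝ} {D : E → E →L[ℝ] ℝ} {Q : E → E → ℝ}
    (h : HasSecondJet f D Q) {I : Set ℝ} {ψ ψ₁ ψ₂ : ℝ → ℝ} {K : ℝ} (hψ : ScalarJet I ψ ψ₁ ψ₂ K)
    (hI : ∀ x, f x ∈ I) :
    HasSecondJet (fun x => ψ (f x)) (fun x => ψ₁ (f x) • D x)
      (fun x y => ψ₂ (f x) * (D x y) ^ 2 + ψ₁ (f x) * Q x y) := by
  obtain ⟨C, h⟩ := h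
  have hC := h.nonneg
  have hK := hψ.nonneg
  refine ⟨K * (C + C ^ 2 + C ^ 3), by positivity, fun x y => ?_, fun x y => ?_, fun x y => ?_,
    fun x y => ?_, fun x y => ?_, fun x => ?_, fun x c y => ?_⟩
  · rw [smul_apply, smul_eq_mul, abs_mul]
    calc _ ≤ K * (C * ‖y‖) := by
          gcongr
          · exact hψ.bound1 _ (hI x)
          · exact h.bound1 x y
      _ ≤ _ := by
          rw [← mul_assoc]; gcongr; nlinarith [sq_nonneg C, pow_nonneg hC 3]
  · calc _ ≤ |ψ₂ (f x)| * |D x y| ^ 2 + |ψ₁ (f x)| * |Q x y| := by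
          refine (abs_add_le _ _).trans (le_of_eq ?_)
          rw [abs_mul, abs_mul, abs_pow]
      _ ≤ K * (C * ‖y‖) ^ 2 + K * (C * ‖y‖ ^ 2) := by
          gcongr
          · exact hψ.bound2 _ (hI x)
          · exact h.bound1 x y
          · exact hψ.bound1 _ (hI x)
          · exact h.bound2 x y
      _ ≤ K * (C + C ^ 2 + C ^ 3) * ‖y‖ ^ 2 := by
          have : 0 ≤ K * C ^ 3 * ‖y‖ ^ 2 := by positivity
          linarith
  · calc _ ≤ K * (C * ‖y‖) := (hψ.rem0 _ (hI x) _ (hI (x + y))).trans (by gcongr; exact h.rem0 x y)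
      _ ≤ _ := by
          rw [← mul_assoc]; gcongr; nlinarith [sq_nonneg C, pow_nonneg hC 3]
  · have e : ψ (f (x + y)) - ψ (f x) - (ψ₁ (f x) • D x) y =
        (ψ (f (x + y)) - ψ (f x) - ψ₁ (f x) * (f (x + y) - f x)) +
        ψ₁ (f x) * (f (x + y) - f x - D x y) := by
      rw [smul_apply, smul_eq_mul]; ring
    rw [e]
    calc _ ≤ K * (C * ‖y‖) ^ 2 + K * (C * ‖y‖ ^ 2) := by
          refine (abs_add_le _ _).trans (add_le_add ?_ ?_)
          · exact (hψ.rem1 _ (hI x) _ (hI (x + y))).trans (by gcongr; exact h.rem0 x y)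
          · rw [abs_mul]
            gcongr
            · exact hψ.bound1 _ (hI x)
            · exact h.rem1 x y
      _ ≤ K * (C + C ^ 2 + C ^ 3) * ‖y‖ ^ 2 := by
          have : 0 ≤ K * C ^ 3 * ‖y‖ ^ 2 := by positivity
          linarith
  -- In the last summand, a² − b² = (a − b)(a + b) for the increment a and its linear part b makes
  -- the term third order.
  · have e : ψ (f (x + y)) - ψ (f x) - (ψ₁ (f x) • D x) y -
          1 / 2 * (ψ₂ (f x) * (D x y) ^ 2 + ψ₁ (f x) * Q x y) =
        (ψ (f (x + y)) - ψ (f x) - ψ₁ (f x) * (f (x + y) - f x) -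
          1 / 2 * ψ₂ (f x) * (f (x + y) - f x) ^ 2) +
        ψ₁ (f x) * (f (x + y) - f x - D x y - 1 / 2 * Q x y) +
        1 / 2 * ψ₂ (f x) * ((f (x + y) - f x - D x y) * (f (x + y) - f x + D x y)) := by
      rw [smul_apply, smul_eq_mul]; ring
    rw [e]
    calc _ ≤ K * (C * ‖y‖) ^ 3 + K * (C * ‖y‖ ^ 3) +
          1 / 2 * K * ((C * ‖y‖ ^ 2) * (C * ‖y‖ + C * ‖y‖)) := by
          refine (abs_add_le _ _).trans (add_le_add ((abs_add_le _ _).trans (add_le_add ?_ ?_)) ?_)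
          · exact (hψ.rem2 _ (hI x) _ (hI (x + y))).trans (by gcongr; exact h.rem0 x y)
          · rw [abs_mul]
            gcongr
            · exact hψ.bound1 _ (hI x)
            · exact h.rem2 x y
          · rw [abs_mul, abs_mul, abs_mul, abs_of_nonneg (by norm_num : (0 : ℝ) ≤ 1 / 2)]
            gcongr
            · exact hψ.bound2 _ (hI x)
            · exact h.rem1 x y
            · exact (abs_add_le _ _).trans (add_le_add (h.rem0 x y) (h.bound1 x y))
      _ = K * (C + C ^ 2 + C ^ 3) * ‖y‖ ^ 3 := by ring
  · have := h.continuous_quad x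
    fun_prop
  · rw [map_smul, smul_eq_mul, h.quad_smul]; ring

end JetCalculus

/-! ### Taylor bounds for exp, log and arctan -/

section ScalarJets

theorem scalarJet_exp (M : ℝ) : ScalarJet (Set.Iic M) Real.exp Real.exp Real.exp (Real.exp M) := by
  have hb : ∀ a ∈ Set.Iic M, |Real.exp a| ≤ Real.exp M := fun a ha => by
    rw [abs_of_pos (Real.exp_pos a)]; exact Real.exp_le_exp.2 ha
  exact .of_hasDerivAt Set.ordConnected_Iic (Real.exp_pos M).le
    (fun a _ => Real.hasDerivAt_exp a) (fun a _ => Real.hasDerivAt_exp a)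
    (fun a _ => Real.hasDerivAt_exp a) hb hb hb

theorem scalarJet_mul_left (c : ℝ) : ScalarJet Set.univ (fun a => c * a) (fun _ => c)
    (fun _ => 0) |c| := by
  refine .of_hasDerivAt (ψ₃ := fun _ => 0) Set.ordConnected_univ (abs_nonneg c)
    (fun a _ => ?_) (fun a _ => hasDerivAt_const _ _) (fun a _ => hasDerivAt_const _ _)
    (fun a _ => le_rfl) (fun a _ => by simp) (fun a _ => by simp)
  simpa using (hasDerivAt_id a).const_mul c

theorem scalarJet_log {c : ℝ} (hc : 0 < c) :
    ScalarJet (Set.Ici c) Real.log (fun a => a⁻¹) (fun a => -(a ^ 2)⁻¹)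
      (c⁻¹ + (c ^ 2)⁻¹ + 2 * (c ^ 3)⁻¹) := by
  have hpos : ∀ a ∈ Set.Ici c, 0 < a := fun a ha => hc.trans_le ha
  have p1 : 0 < c⁻¹ := by positivity
  have p2 : 0 < (c ^ 2)⁻¹ := by positivity
  have p3 : 0 < (c ^ 3)⁻¹ := by positivity
  refine .of_hasDerivAt (ψ₃ := fun a => 2 * (a ^ 3)⁻¹) Set.ordConnected_Ici (by positivity)
    (fun a ha => Real.hasDerivAt_log (hpos a ha).ne') (fun a ha => ?_) (fun a ha => ?_)
    (fun a ha => ?_) (fun a ha => ?_) (fun a ha => ?_)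
  · simpa using hasDerivAt_inv (hpos a ha).ne'
  · have h0 := (hpos a ha).ne'
    have := ((hasDerivAt_pow 2 a).inv (pow_ne_zero 2 h0)).neg
    refine this.congr_deriv ?_
    field_simp
    norm_num
    ring
  · have := hpos a ha
    rw [abs_of_pos (by positivity)]
    have : a⁻¹ ≤ c⁻¹ := by gcongr; exact ha
    linarith
  · have := hpos a ha
    rw [abs_neg, abs_of_pos (by positivity)]
    have : (a ^ 2)⁻¹ ≤ (c ^ 2)⁻¹ := by gcongr; exact ha
    linarith
  · have := hpos a ha
    rw [abs_of_pos (by positivity)]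
    have : (a ^ 3)⁻¹ ≤ (c ^ 3)⁻¹ := by gcongr; exact ha
    linarith

/-- Composing with arctan makes any function bounded without ever increasing its gradient; 8 is a
crude common bound for three derivatives. -/
theorem scalarJet_arctan :
    ScalarJet Set.univ Real.arctan (fun a => 1 / (1 + a ^ 2))
      (fun a => -(2 * a) / (1 + a ^ 2) ^ 2) 8 := by
  refine .of_hasDerivAt (ψ₃ := fun a => (6 * a ^ 2 - 2) / (1 + a ^ 2) ^ 3) Set.ordConnected_univ
    (by norm_num) (fun a _ => Real.hasDerivAt_arctan a) (fun a _ => ?_) (fun a _ => ?_)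
    (fun a _ => ?_) (fun a _ => ?_) (fun a _ => ?_)
  · have hp : (1 : ℝ) + a ^ 2 ≠ 0 := by positivity
    have := (hasDerivAt_const a (1 : ℝ)).div ((hasDerivAt_pow 2 a).const_add 1) hp
    refine this.congr_deriv ?_
    simp
  · have hp : (1 : ℝ) + a ^ 2 ≠ 0 := by positivity
    have := (((hasDerivAt_id a).const_mul 2).neg).div (((hasDerivAt_pow 2 a).const_add 1).pow 2)
      (pow_ne_zero 2 hp)
    refine this.congr_deriv ?_
    simp only [id, Nat.cast_ofNat, Pi.neg_apply, Pi.pow_apply]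
    field_simp
    ring
  · rw [abs_of_pos (by positivity), div_le_iff₀ (by positivity)]
    nlinarith [sq_nonneg a]
  · rw [abs_div, abs_of_pos (by positivity : (0 : ℝ) < (1 + a ^ 2) ^ 2),
      div_le_iff₀ (by positivity), abs_neg, abs_mul, abs_two]
    nlinarith [sq_nonneg (|a| - 1), sq_abs a, sq_nonneg (a ^ 2)]
  · rw [abs_div, abs_of_pos (by positivity : (0 : ℝ) < (1 + a ^ 2) ^ 3),
      div_le_iff₀ (by positivity)]
    have : (1 + a ^ 2) ≤ (1 + a ^ 2) ^ 3 := le_self_pow₀ (by nlinarith [sq_nonneg a]) (by norm_num)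
    rw [abs_le]
    constructor <;> nlinarith [sq_nonneg a]

end ScalarJets

/-! ### A smooth substitute for the Euclidean norm -/

section SmoothNorm

variable {F : Type*} [NormedAddCommGroup F] [InnerProductSpace ℝ F]

/-- A smooth upper approximation of the norm. -/
noncomputable def smoothNorm (ε : ℝ) (x : F) : ℝ := √(‖x‖ ^ 2 + ε ^ 2)

theorem le_smoothNorm {ε : ℝ} (x : F) : ‖x‖ ≤ smoothNorm ε x :=
  Real.le_sqrt_of_sq_le (by nlinarith [sq_nonneg ε])

theorem smoothNorm_le {ε : ℝ} (hε : 0 ≤ ε) (x : F) : smoothNorm ε x ≤ ‖x‖ + ε :=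
  Real.sqrt_le_iff.2 ⟨by positivity, by nlinarith [mul_nonneg (norm_nonneg x) hε]⟩

theorem smoothNorm_pos {ε : ℝ} (hε : 0 < ε) (x : F) : 0 < smoothNorm ε x :=
  Real.sqrt_pos.2 (by positivity)

theorem smoothNorm_sq (ε : ℝ) (x : F) : smoothNorm ε x ^ 2 = ‖x‖ ^ 2 + ε ^ 2 :=
  Real.sq_sqrt (by positivity)

/-- With r the smoothed norm, everything follows from r(x + y)² = r(x)² + 2⟨x, y⟩ + ‖y‖², while r ≥
ε makes the constants uniform. -/
theorem hasSecondJet_smoothNorm {ε : ℝ} (hε : 0 < ε) :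
    HasSecondJet (fun x : F => smoothNorm ε x) (fun x => (smoothNorm ε x)⁻¹ • innerSL ℝ x)
      (fun x y => ‖y‖ ^ 2 / smoothNorm ε x - (inner ℝ x y) ^ 2 / smoothNorm ε x ^ 3) := by
  have hr := fun x : F => smoothNorm_pos hε x
  have hεr : ∀ x : F, ε ≤ smoothNorm ε x := fun x =>
    Real.le_sqrt_of_sq_le (by nlinarith [sq_nonneg ‖x‖])
  have hs : ∀ x y : F, |inner ℝ x y| ≤ smoothNorm ε x * ‖y‖ := fun x y =>
    (abs_real_inner_le_norm x y).trans (by gcongr; exact le_smoothNorm x)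
  have B1 : ∀ x y : F, |inner ℝ x y / smoothNorm ε x| ≤ ‖y‖ := fun x y => by
    rw [abs_div, abs_of_pos (hr x), div_le_iff₀ (hr x), mul_comm]; exact hs x y
  have hq : ∀ x y : F, smoothNorm ε (x + y) ^ 2 =
      smoothNorm ε x ^ 2 + 2 * inner ℝ x y + ‖y‖ ^ 2 := fun x y => by
    rw [smoothNorm_sq, smoothNorm_sq, norm_add_sq_real]; ring
  have B0 : ∀ x y : F, |smoothNorm ε (x + y) - smoothNorm ε x| ≤ ‖y‖ := fun x y => by
    have h1 := hq x y
    have h2 := abs_le.1 (hs x y)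
    have h3 := hr x
    have h4 := hr (x + y)
    have h5 := norm_nonneg y
    refine abs_le.2 ⟨?_, ?_⟩
    · by_contra hc
      push Not at hc
      nlinarith
    · by_contra hc
      push Not at hc
      nlinarith
  have B2 : ∀ x y : F, |‖y‖ ^ 2 / smoothNorm ε x - (inner ℝ x y) ^ 2 / smoothNorm ε x ^ 3| ≤
      2 * (‖y‖ ^ 2 / smoothNorm ε x) := fun x y => by
    have h1 : (inner ℝ x y) ^ 2 / smoothNorm ε x ^ 3 =
        (inner ℝ x y / smoothNorm ε x) ^ 2 / smoothNorm ε x := by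
      have := (hr x).ne'
      field_simp
    have h2 : (inner ℝ x y / smoothNorm ε x) ^ 2 ≤ ‖y‖ ^ 2 := by
      rw [← sq_abs]; gcongr; exact B1 x y
    have h3 : (inner ℝ x y / smoothNorm ε x) ^ 2 / smoothNorm ε x ≤ ‖y‖ ^ 2 / smoothNorm ε x := by
      have := (hr x).le
      gcongr
    have h4 : 0 ≤ (inner ℝ x y / smoothNorm ε x) ^ 2 / smoothNorm ε x := by
      have := (hr x).le
      positivity
    rw [h1]
    exact abs_le.2 ⟨by linarith, by linarith⟩
  have C0 : 0 < 1 + 2 / ε + 3 / ε ^ 2 := by positivity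
  have D1 : ∀ x y : F, ((smoothNorm ε x)⁻¹ • innerSL ℝ x) y = inner ℝ x y / smoothNorm ε x :=
    fun x y => by
      rw [smul_apply, innerSL_apply_apply, smul_eq_mul, div_eq_inv_mul]
  have E1 : ∀ x y : F, ‖y‖ ^ 2 / smoothNorm ε x ≤ 1 / ε * ‖y‖ ^ 2 := fun x y => by
    rw [one_div, ← div_eq_inv_mul]
    gcongr
    exact hεr x
  have c1 : 0 < 1 / ε := by positivity
  have c2 : 0 < 1 / ε ^ 2 := by positivity
  refine ⟨1 + 2 / ε + 3 / ε ^ 2, C0.le, fun x y => ?_, fun x y => ?_, fun x y => ?_,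
    fun x y => ?_, fun x y => ?_, fun x => ?_, fun x c y => ?_⟩
  · rw [D1]
    refine (B1 x y).trans (le_mul_of_one_le_left (norm_nonneg y) ?_)
    have : 0 < 2 / ε + 3 / ε ^ 2 := by positivity
    linarith
  · refine (B2 x y).trans ?_
    have := E1 x y
    have h3 : 0 ≤ (1 + 3 / ε ^ 2) * ‖y‖ ^ 2 := by positivity
    rw [show (1 + 2 / ε + 3 / ε ^ 2) * ‖y‖ ^ 2 =
      2 * (1 / ε * ‖y‖ ^ 2) + (1 + 3 / ε ^ 2) * ‖y‖ ^ 2 by ring]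
    linarith
  · refine (B0 x y).trans (le_mul_of_one_le_left (norm_nonneg y) ?_)
    have : 0 < 2 / ε + 3 / ε ^ 2 := by positivity
    linarith
  · rw [D1]
    have h0 := hr x
    set r := smoothNorm ε x
    set d := smoothNorm ε (x + y) - r with hd
    have e : d - inner ℝ x y / r = ‖y‖ ^ 2 / r / 2 - d ^ 2 / r / 2 := by
      have h1 := hq x y
      field_simp
      rw [hd]
      linear_combination h1
    have h2 : d ^ 2 ≤ ‖y‖ ^ 2 := by rw [← sq_abs]; gcongr; exact B0 x y
    have h3 : d ^ 2 / r ≤ ‖y‖ ^ 2 / r := by gcongr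
    have h4 : 0 ≤ d ^ 2 / r := by positivity
    have h5 := E1 x y
    have h6 : |d - inner ℝ x y / r| ≤ 1 / ε * ‖y‖ ^ 2 := by
      rw [e]
      exact abs_le.2 ⟨by linarith, by linarith⟩
    refine h6.trans ?_
    gcongr
    have : 0 < 1 + 1 / ε + 3 / ε ^ 2 := by positivity
    have e2 : 2 / ε = 1 / ε + 1 / ε := by ring
    linarith
  · rw [D1]
    have h0 := hr x
    have b0 := B0 x y
    have b1 := B1 x y
    have b2 := B2 x y
    have hεr := hεr x
    have hs := hs x y
    have h1 := hq x y
    set r := smoothNorm ε x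
    set d := smoothNorm ε (x + y) - r with hd
    set s := inner ℝ x y
    have hρ := norm_nonneg y
    have fin : 3 * (‖y‖ ^ 3 / r ^ 2) ≤ (1 + 2 / ε + 3 / ε ^ 2) * ‖y‖ ^ 3 := by
      have : ‖y‖ ^ 3 / r ^ 2 ≤ ‖y‖ ^ 3 / ε ^ 2 := by gcongr
      have h3 : 0 ≤ (1 + 2 / ε) * ‖y‖ ^ 3 := by positivity
      rw [show (1 + 2 / ε + 3 / ε ^ 2) * ‖y‖ ^ 3 =
        (1 + 2 / ε) * ‖y‖ ^ 3 + 3 * (‖y‖ ^ 3 / ε ^ 2) by ring]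
      linarith
    refine le_trans ?_ fin
    -- For ‖y‖ ≤ r, the quadratic identity turns the remainder into an explicit third-order
    -- fraction. Otherwise each of its three terms is by itself at most ‖y‖³ / r².
    rcases le_total ‖y‖ r with hle | hle
    · have e : d - s / r - 1 / 2 * (‖y‖ ^ 2 / r - s ^ 2 / r ^ 3) =
          (d ^ 3 * (4 * r + d) - (4 * s * ‖y‖ ^ 2 + ‖y‖ ^ 4)) / (8 * r ^ 3) := by
        have h2 : ‖y‖ ^ 2 = d * (2 * r + d) - 2 * s := by rw [hd]; linear_combination -h1
        have h3 : ‖y‖ ^ 4 = (d * (2 * r + d) - 2 * s) ^ 2 := by rw [← h2]; ring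
        rw [h3, h2]
        field_simp
        ring
      rw [e, abs_div, abs_of_pos (by positivity : 0 < 8 * r ^ 3), div_le_iff₀ (by positivity)]
      have k1 : |d ^ 3 * (4 * r + d)| ≤ ‖y‖ ^ 3 * (4 * r + r) := by
        rw [abs_mul, abs_pow]
        gcongr
        refine (abs_add_le _ _).trans ?_
        rw [abs_of_pos (by positivity : 0 < 4 * r)]
        linarith
      have k2 : |4 * s * ‖y‖ ^ 2 + ‖y‖ ^ 4| ≤ 4 * (r * ‖y‖) * ‖y‖ ^ 2 + ‖y‖ ^ 3 * r := by
        refine (abs_add_le _ _).trans (add_le_add ?_ ?_)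
        · rw [abs_mul, abs_mul, abs_of_pos (by norm_num : (0 : ℝ) < 4),
            abs_of_nonneg (sq_nonneg ‖y‖)]
          gcongr
        · rw [abs_of_nonneg (by positivity), pow_succ]
          gcongr
      have e2 : 3 * (‖y‖ ^ 3 / r ^ 2) * (8 * r ^ 3) = 24 * (‖y‖ ^ 3 * r) := by
        field_simp
        ring
      rw [e2]
      refine (abs_sub _ _).trans ?_
      have : 0 ≤ ‖y‖ ^ 3 * r := by positivity
      nlinarith
    · have m1 : ‖y‖ ≤ ‖y‖ ^ 3 / r ^ 2 := by
        rw [le_div_iff₀ (by positivity)]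
        calc ‖y‖ * r ^ 2 ≤ ‖y‖ * ‖y‖ ^ 2 := by gcongr
          _ = ‖y‖ ^ 3 := by ring
      have m2 : ‖y‖ ^ 2 / r ≤ ‖y‖ ^ 3 / r ^ 2 := by
        rw [div_le_div_iff₀ h0 (by positivity)]
        calc ‖y‖ ^ 2 * r ^ 2 = ‖y‖ ^ 2 * r * r := by ring
          _ ≤ ‖y‖ ^ 2 * ‖y‖ * r := by gcongr
          _ = ‖y‖ ^ 3 * r := by ring
      have a0 := abs_le.1 b0
      have a1 := abs_le.1 b1
      have a2 := abs_le.1 b2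
      exact abs_le.2 ⟨by linarith, by linarith⟩
  · fun_prop
  · rw [norm_smul, inner_smul_right, mul_pow, Real.norm_eq_abs, sq_abs]
    ring

end SmoothNorm

/-! ### Two-copy Gaussian concentration -/

section Concentration

variable {E : Type*} [NormedAddCommGroup E] [NormedSpace ℝ E] [CompleteSpace E]
  [MeasurableSpace E] [BorelSpace E] [SecondCountableTopology E]

theorem HasSecondJet.continuous {f : E → ℝ} {D : E → E →L[ℝ] ℝ} {Q : E → E → ℝ}
    (h : HasSecondJet f D Q) : Continuous f := h.elim fun _ h => h.continuous

theorem integrable_dual_sq (μ : Measure E) [IsGaussian μ] (L : StrongDual ℝ E) :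
    Integrable (fun x => (L x) ^ 2) μ := (IsGaussian.memLp_dual μ L 2 (by simp)).integrable_sq

/-- Exponential concentration of `F` around an independent copy. -/
theorem HasSecondJet.integral_exp_sub_le {F : E → ℝ} {D : E → E →L[ℝ] ℝ} {Q : E → E → ℝ}
    (h : HasSecondJet F D Q) {B : ℝ} (hB : ∀ x, |F x| ≤ B) {μ : Measure E} [IsGaussian μ]
    (hμ : IsCentered μ) (hD : ∀ x, ∫ z, (D x z) ^ 2 ∂μ ≤ 1) (t : ℝ) :
    Integrable (fun p : E × E => Real.exp (t * F p.1 + -t * F p.2)) (μ.prod μ) ∧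
    ∫ p, Real.exp (t * F p.1 + -t * F p.2) ∂(μ.prod μ) ≤ Real.exp (t ^ 2) := by
  have j1 := (h.comp_affine (ContinuousLinearMap.fst ℝ E E) 0).scalar_comp (scalarJet_mul_left t)
    (fun _ => Set.mem_univ _)
  have j2 := (h.comp_affine (ContinuousLinearMap.snd ℝ E E) 0).scalar_comp
    (scalarJet_mul_left (-t)) (fun _ => Set.mem_univ _)
  have j3 := (j1.add j2).scalar_comp (scalarJet_exp (2 * (|t| * B))) (fun p => by
    have e1 : |t * F p.1| ≤ |t| * B := by rw [abs_mul]; gcongr; exact hB _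
    have e2 : |-t * F p.2| ≤ |t| * B := by rw [abs_mul, abs_neg]; gcongr; exact hB _
    have := (abs_le.1 e1).2
    have := (abs_le.1 e2).2
    simp only [ContinuousLinearMap.fst, ContinuousLinearMap.snd, add_zero, Set.mem_Iic]
    change t * F p.1 + -t * F p.2 ≤ _
    linarith)
  simp only [ContinuousLinearMap.coe_fst', ContinuousLinearMap.coe_snd', add_zero, zero_mul,
    zero_add] at j3
  obtain ⟨C, j⟩ := j3
  obtain ⟨_, h'⟩ := id h
  refine ⟨j.integrable _, ?_⟩
  -- The reference law is that of (x, x), on which the exponential is identically 1.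
  have diag : IsCentered (μ.map ((ContinuousLinearMap.id ℝ E).prod (ContinuousLinearMap.id ℝ E))) :=
    hμ.map _
  have main := j.integral_le_exp_mul (fun p => (Real.exp_pos _).le) (hμ.prod hμ) diag
    (κ := t ^ 2) (sq_nonneg t) (fun p => ?_)
  · refine main.trans (le_of_eq ?_)
    have : ∫ p, Real.exp (t * F p.1 + -t * F p.2)
        ∂(μ.map ((ContinuousLinearMap.id ℝ E).prod (ContinuousLinearMap.id ℝ E))) = 1 := by
      rw [integral_map (by fun_prop) j.continuous.aestronglyMeasurable]
      simp
    rw [this, mul_one]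
  -- Both laws have the same marginals, so the Q terms cancel. The squared linear term averages at
  -- most 2 t² for an independent pair, which has no cross term, and is nonnegative on the diagonal;
  -- hence κ = t².
  · have q1 : ∀ x : E, Integrable (fun z : E × E => Q x z.1) (μ.prod μ) := fun x =>
      (h'.integrable_quad μ x).comp_fst μ
    have q2 : ∀ x : E, Integrable (fun z : E × E => Q x z.2) (μ.prod μ) := fun x =>
      (h'.integrable_quad μ x).comp_snd μ
    have q3 : ∀ x, ∫ z : E × E, Q x z.1 ∂(μ.prod μ) = ∫ z, Q x z ∂μ := fun x => by
      rw [integral_fun_fst]; simp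
    have q4 : ∀ x, ∫ z : E × E, Q x z.2 ∂(μ.prod μ) = ∫ z, Q x z ∂μ := fun x => by
      rw [integral_fun_snd]; simp
    set w := Real.exp (t * F p.1 + -t * F p.2) with hw
    have hw0 : 0 < w := Real.exp_pos _
    set L : E × E →L[ℝ] ℝ := t • (D p.1).comp (ContinuousLinearMap.fst ℝ E E) +
      -t • (D p.2).comp (ContinuousLinearMap.snd ℝ E E) with hL
    have l1 : ∫ y, (w * (L y) ^ 2 + w * (t * Q p.1 y.1 + -t * Q p.2 y.2)) ∂(μ.prod μ) =
        w * ∫ y, (L y) ^ 2 ∂(μ.prod μ) +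
          w * (t * ∫ z, Q p.1 z ∂μ + -t * ∫ z, Q p.2 z ∂μ) := by
      rw [integral_add, integral_const_mul, integral_const_mul, integral_add, integral_const_mul,
        integral_const_mul, q3, q4]
      · exact (q1 _).const_mul _
      · exact (q2 _).const_mul _
      · exact (integrable_dual_sq _ L).const_mul _
      · exact (((q1 _).const_mul _).add ((q2 _).const_mul _)).const_mul _
    have l2 : ∫ y, (w * (L y) ^ 2 + w * (t * Q p.1 y.1 + -t * Q p.2 y.2))
          ∂(μ.map ((ContinuousLinearMap.id ℝ E).prod (ContinuousLinearMap.id ℝ E))) ≥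
          w * (t * ∫ z, Q p.1 z ∂μ + -t * ∫ z, Q p.2 z ∂μ) := by
      have c1 := h'.continuous_quad p.1
      have c2 := h'.continuous_quad p.2
      rw [integral_map (by fun_prop) (by
        refine Continuous.aestronglyMeasurable ?_
        fun_prop)]
      have i1 := (h'.integrable_quad μ p.1).const_mul t
      have i2 := (h'.integrable_quad μ p.2).const_mul (-t)
      rw [← integral_const_mul, ← integral_const_mul, ← integral_add i1 i2, ← integral_const_mul]
      refine integral_mono ((i1.add i2).const_mul w) ?_ fun z => ?_
      · exact ((integrable_dual_sq μ (L.comp ((ContinuousLinearMap.id ℝ E).prod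
          (ContinuousLinearMap.id ℝ E)))).const_mul w).add ((i1.add i2).const_mul w)
      · have : 0 ≤ w * (L (((ContinuousLinearMap.id ℝ E).prod (ContinuousLinearMap.id ℝ E)) z)) ^ 2 :=
          by positivity
        simpa using this
    have l3 : ∫ y, (L y) ^ 2 ∂(μ.prod μ) ≤ 2 * t ^ 2 := by
      rw [integral_sq_prod hμ hμ]
      have e1 : ∫ x, (L (x, 0)) ^ 2 ∂μ = t ^ 2 * ∫ x, (D p.1 x) ^ 2 ∂μ := by
        rw [← integral_const_mul]
        simp [hL, mul_pow]
      have e2 : ∫ x, (L (0, x)) ^ 2 ∂μ = t ^ 2 * ∫ x, (D p.2 x) ^ 2 ∂μ := by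
        rw [← integral_const_mul]
        simp [hL, mul_pow]
      rw [e1, e2]
      have := mul_le_mul_of_nonneg_left (hD p.1) (sq_nonneg t)
      have := mul_le_mul_of_nonneg_left (hD p.2) (sq_nonneg t)
      linarith
    have l4 := mul_le_mul_of_nonneg_left l3 hw0.le
    refine l1.le.trans ?_
    refine le_trans ?_ (add_le_add_left l2 _)
    linarith

/-- The weights of a soft minimum form a subprobability vector. -/
theorem integral_sq_weighted_le {ι : Type*} [Fintype ι] {μ : Measure E} [IsGaussian μ]
    {L : ι → StrongDual ℝ E} (hL : ∀ i, ∫ z, (L i z) ^ 2 ∂μ ≤ 1) {w : ι → ℝ} (hw : ∀ i, 0 ≤ w i)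
    (hw1 : ∑ i, w i ≤ 1) : ∫ z, (∑ i, w i * L i z) ^ 2 ∂μ ≤ 1 := by
  have pt : ∀ z, (∑ i, w i * L i z) ^ 2 ≤ ∑ i, w i * (L i z) ^ 2 := fun z => by
    have := Finset.sum_sq_le_sum_mul_sum_of_sq_le_mul Finset.univ (r := fun i => w i * L i z)
      (f := w) (g := fun i => w i * (L i z) ^ 2) (fun i _ => hw i)
      (fun i _ => mul_nonneg (hw i) (sq_nonneg _)) (fun i _ => le_of_eq (by ring))
    refine this.trans (mul_le_of_le_one_left ?_ hw1)
    exact Finset.sum_nonneg fun i _ => mul_nonneg (hw i) (sq_nonneg _)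
  have hi : ∀ i, Integrable (fun z => w i * (L i z) ^ 2) μ := fun i =>
    (integrable_dual_sq μ (L i)).const_mul _
  calc ∫ z, (∑ i, w i * L i z) ^ 2 ∂μ ≤ ∫ z, ∑ i, w i * (L i z) ^ 2 ∂μ :=
        integral_mono_of_nonneg (Filter.Eventually.of_forall fun z => sq_nonneg _)
          (integrable_finsetSum _ fun i _ => hi i) (Filter.Eventually.of_forall pt)
    _ = ∑ i, w i * ∫ z, (L i z) ^ 2 ∂μ := by
        rw [integral_finsetSum _ fun i _ => hi i]
        simp only [integral_const_mul]
    _ ≤ ∑ i, w i * 1 := Finset.sum_le_sum fun i _ => mul_le_mul_of_nonneg_left (hL i) (hw i)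
    _ ≤ 1 := by simpa using hw1

theorem tendsto_mul_arctan_div (T : ℝ) :
    Filter.Tendsto (fun m : ℕ => (m : ℝ) * Real.arctan (T / m)) Filter.atTop (nhds T) := by
  have h : HasDerivAt (fun s : ℝ => Real.arctan (T * s)) T 0 := by
    have := ((hasDerivAt_id' (0 : ℝ)).const_mul T).arctan
    simpa using this
  have h2 := h.tendsto_slope_zero_right.comp
    (tendsto_inv_atTop_nhdsGT_zero.comp (tendsto_natCast_atTop_atTop (R := ℝ)))
  refine h2.congr fun m => ?_
  simp [div_eq_mul_inv]

/-- Two-copy concentration for a minimum of finitely many functions with gradients of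
norm at most one. -/
theorem two_copy_concentration {ι : Type*} [Fintype ι] {μ : Measure E} [IsGaussian μ]
    (hμ : IsCentered μ) {φ : ι → E → ℝ} {D : ι → E → E →L[ℝ] ℝ} {Q : ι → E → E → ℝ}
    (h : ∀ i, HasSecondJet (φ i) (D i) (Q i)) (hD : ∀ i x, ∫ z, (D i x z) ^ 2 ∂μ ≤ 1)
    (T : ℝ) {t : ℝ} (ht : 0 ≤ t) :
    μ.real {x | ∃ i, φ i x < -T} * μ.real {x | ∀ i, 0 ≤ φ i x} ≤ Real.exp (t ^ 2 - t * T) := by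
  rcases isEmpty_or_nonempty ι with hι | hι
  · simp; positivity
  have hc : ∀ i, Continuous (φ i) := fun i => (h i).continuous
  have mA : MeasurableSet {x | ∃ i, φ i x < -T} := by
    rw [Set.ofPred_exists]
    exact MeasurableSet.iUnion fun i => measurableSet_lt (hc i).measurable measurable_const
  have mB : MeasurableSet {x | ∀ i, 0 ≤ φ i x} := by
    rw [Set.ofPred_forall]
    exact MeasurableSet.iInter fun i => measurableSet_le measurable_const (hc i).measurable
  set N : ℝ := (Fintype.card ι : ℝ) with hN
  have hN1 : 1 ≤ N := by rw [hN]; exact_mod_cast Fintype.card_pos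
  set A := {x | ∃ i, φ i x < -T}
  set B := {x | ∀ i, 0 ≤ φ i x}
  -- With β = m, the soft minimum F = −β⁻¹ log Σ exp(−β² arctan(φᵢ/β)) is bounded, and its gradient
  -- is a combination of those of the φᵢ with nonnegative weights of sum at most 1. On B it is at
  -- least −β⁻¹ log N, and on A at most −β arctan(T/β), which tends to −T.
  have main : ∀ m : ℕ, 0 < m → μ.real A * μ.real B *
      Real.exp (t * (m * Real.arctan (T / m) - (m : ℝ)⁻¹ * Real.log N)) ≤ Real.exp (t ^ 2) := by
    intro m hm
    have hm' : (0 : ℝ) < m := by exact_mod_cast hm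
    set β : ℝ := (m : ℝ) with hβ
    have hq : ∀ x : ℝ, -(β * β) * Real.arctan x ≤ β * β * 2 := fun x => by
      have := Real.neg_pi_div_two_lt_arctan x
      have := Real.pi_le_four
      nlinarith [mul_pos hm' hm']
    have hq' : ∀ x : ℝ, -(β * β * 2) ≤ -(β * β) * Real.arctan x := fun x => by
      have := Real.arctan_lt_pi_div_two x
      have := Real.pi_le_four
      nlinarith [mul_pos hm' hm']
    have j1 : ∀ i, _ := fun i => ((((h i).scalar_comp (scalarJet_mul_left β⁻¹)
      (fun _ => Set.mem_univ _)).scalar_comp scalarJet_arctan (fun _ => Set.mem_univ _)).scalar_comp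
      (scalarJet_mul_left (-(β * β))) (fun _ => Set.mem_univ _)).scalar_comp
      (scalarJet_exp (β * β * 2)) (fun x => hq _)
    let θ : ι → E → ℝ := fun i x => Real.exp (-(β * β) * Real.arctan (β⁻¹ * φ i x))
    have hθ : ∀ i x, 0 < θ i x := fun i x => Real.exp_pos _
    let H : E → ℝ := fun x => ∑ i, θ i x
    have hH : ∀ x, Real.exp (-(β * β * 2)) ≤ H x := fun x => by
      refine le_trans ?_ (Finset.single_le_sum (fun i _ => (hθ i x).le)
        (Finset.mem_univ (Classical.arbitrary ι)))
      exact Real.exp_le_exp.2 (hq' _)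
    have hH' : ∀ x, H x ≤ N * Real.exp (β * β * 2) := fun x => by
      have : H x ≤ ∑ _ : ι, Real.exp (β * β * 2) :=
        Finset.sum_le_sum fun i _ => Real.exp_le_exp.2 (hq _)
      simpa [hN] using this
    have hH0 : ∀ x, 0 < H x := fun x => (Real.exp_pos _).trans_le (hH x)
    have j2 := ((HasSecondJet.sum Finset.univ j1).scalar_comp
      (scalarJet_log (Real.exp_pos (-(β * β * 2)))) hH).scalar_comp
      (scalarJet_mul_left (-β⁻¹)) (fun _ => Set.mem_univ _)
    let F : E → ℝ := fun x => -β⁻¹ * Real.log (H x)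
    have hFb : ∀ x, |F x| ≤ β⁻¹ * (β * β * 2 + Real.log N) := fun x => by
      have a1 := (Real.le_log_iff_exp_le (hH0 x)).2 (hH x)
      have a2 := Real.log_le_log (hH0 x) (hH' x)
      rw [Real.log_mul (by positivity) (Real.exp_pos _).ne', Real.log_exp] at a2
      have a3 := Real.log_nonneg hN1
      simp only [F]
      rw [abs_mul, abs_neg, abs_of_pos (inv_pos.2 hm')]
      gcongr
      exact abs_le.2 ⟨by linarith, by linarith⟩
    have hconc := j2.integral_exp_sub_le hFb hμ (fun x => ?_) t
    · obtain ⟨hint, hle⟩ := hconc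
      set a := Real.exp (t * (β * Real.arctan (T / β) - β⁻¹ * Real.log N)) with ha
      have hset : B ×ˢ A ⊆ {p : E × E | a ≤ Real.exp (t * F p.1 + -t * F p.2)} := by
        rintro ⟨y, x⟩ ⟨hy, i, hx⟩
        have f1 : -(β⁻¹ * Real.log N) ≤ F y := by
          have : H y ≤ N := by
            have : H y ≤ ∑ _ : ι, (1 : ℝ) := Finset.sum_le_sum fun i _ => by
              refine Real.exp_le_one_iff.2 ?_
              have := Real.arctan_nonneg.2 (mul_nonneg (inv_pos.2 hm').le (hy i))
              nlinarith [mul_pos hm' hm']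
            simpa [hN] using this
          have := Real.log_le_log (hH0 y) this
          simp only [F]
          have := mul_le_mul_of_nonneg_left this (inv_pos.2 hm').le
          linarith
        have f2 : F x ≤ -(β * Real.arctan (T / β)) := by
          have h1 : Real.exp (β * β * Real.arctan (T / β)) ≤ H x := by
            refine le_trans ?_ (Finset.single_le_sum (fun i _ => (hθ i x).le) (Finset.mem_univ i))
            refine Real.exp_le_exp.2 ?_
            have : Real.arctan (β⁻¹ * φ i x) ≤ -Real.arctan (T / β) := by
              rw [← Real.arctan_neg]
              refine Real.arctan_mono ?_
              rw [← neg_div, div_eq_inv_mul]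
              exact mul_le_mul_of_nonneg_left hx.le (inv_pos.2 hm').le
            nlinarith [mul_pos hm' hm']
          have h2 := (Real.le_log_iff_exp_le (hH0 x)).2 h1
          have h3 := mul_le_mul_of_nonneg_left h2 (inv_pos.2 hm').le
          have h4 : β⁻¹ * (β * β * Real.arctan (T / β)) = β * Real.arctan (T / β) := by
            field_simp
          simp only [F]
          linarith
        refine Real.exp_le_exp.2 ?_
        simp only
        nlinarith
      have hmk := mul_meas_ge_le_integral_of_nonneg
        (Filter.Eventually.of_forall fun p : E × E => (Real.exp_pos (t * F p.1 + -t * F p.2)).le)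
        hint a
      have hpr : (μ.prod μ).real (B ×ˢ A) = μ.real B * μ.real A := measureReal_prod_prod B A
      have := measureReal_mono (μ := μ.prod μ) hset
      rw [hpr] at this
      calc μ.real A * μ.real B * a ≤ a * (μ.prod μ).real
            {p : E × E | a ≤ Real.exp (t * F p.1 + -t * F p.2)} := by
            rw [mul_comm]
            refine mul_le_mul_of_nonneg_left ?_ (Real.exp_pos _).le
            linarith
        _ ≤ _ := hmk.trans hle
    · have hw : ∑ i, θ i x / H x * (1 / (1 + (β⁻¹ * φ i x) ^ 2)) ≤ 1 := by
        calc _ ≤ ∑ i, θ i x / H x * 1 := by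
              refine Finset.sum_le_sum fun i _ => mul_le_mul_of_nonneg_left ?_
                (div_nonneg (hθ i x).le (hH0 x).le)
              rw [div_le_one (by positivity)]
              linarith [sq_nonneg (β⁻¹ * φ i x)]
          _ = 1 := by
              simp only [mul_one]
              rw [← Finset.sum_div]
              exact div_self (hH0 x).ne'
      have := integral_sq_weighted_le (fun i => hD i x)
        (fun i => mul_nonneg (div_nonneg (hθ i x).le (hH0 x).le)
          (by positivity : 0 ≤ 1 / (1 + (β⁻¹ * φ i x) ^ 2))) hw
      refine le_trans (le_of_eq ?_) this
      congr 1
      ext z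
      congr 1
      simp only [smul_apply, _root_.sum_apply, smul_eq_mul]
      rw [Finset.mul_sum, Finset.mul_sum]
      refine Finset.sum_congr rfl fun i _ => ?_
      change -β⁻¹ * ((H x)⁻¹ * (θ i x * _)) = _
      have := (hH0 x).ne'
      field_simp
  have lim : Filter.Tendsto (fun m : ℕ => μ.real A * μ.real B *
      Real.exp (t * (m * Real.arctan (T / m) - (m : ℝ)⁻¹ * Real.log N))) Filter.atTop
      (nhds (μ.real A * μ.real B * Real.exp (t * (T - 0 * Real.log N)))) := by
    refine Filter.Tendsto.const_mul _ ((Real.continuous_exp.tendsto _).comp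
      (Filter.Tendsto.const_mul _ ((tendsto_mul_arctan_div T).sub
        (Filter.Tendsto.mul_const _ ?_))))
    exact tendsto_inv_atTop_nhds_zero_nat
  have fin := le_of_tendsto lim (Filter.eventually_atTop.2 ⟨1, fun m hm => main m hm⟩)
  rw [zero_mul, sub_zero] at fin
  rw [Real.exp_sub]
  exact (le_div_iff₀ (Real.exp_pos _)).2 fin

end Concentration

/-! ### Gordon's comparison -/

section Gordon

variable {n p : ℕ}

/-- `n × p` matrices with the Hilbert space structure, seen as tuples of rows. -/
abbrev RowSpace (n p : ℕ) : Type := PiLp 2 (fun _ : Fin n => EuclideanSpace ℝ (Fin p))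

/-- The action of a matrix on a fixed vector, as a linear function of the matrix. -/
noncomputable def rowAct (w : EuclideanSpace ℝ (Fin p)) :
    RowSpace n p →L[ℝ] EuclideanSpace ℝ (Fin n) :=
  ((PiLp.continuousLinearEquiv 2 ℝ (fun _ : Fin n => ℝ)).symm :
      (Fin n → ℝ) →L[ℝ] EuclideanSpace ℝ (Fin n)).comp
    (ContinuousLinearMap.pi fun k => (innerSL ℝ w).comp
      (PiLp.proj 2 (fun _ : Fin n => EuclideanSpace ℝ (Fin p)) k))

theorem rowAct_apply (w : EuclideanSpace ℝ (Fin p)) (G : RowSpace n p) (k : Fin n) :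
    rowAct w G k = inner ℝ w (G k) := rfl

/-- The rank one matrix `q wᵀ`. -/
noncomputable def rankOneRows (q : EuclideanSpace ℝ (Fin n)) (w : EuclideanSpace ℝ (Fin p)) :
    RowSpace n p := WithLp.toLp 2 fun k => q k • w

theorem inner_rankOneRows (q : EuclideanSpace ℝ (Fin n)) (w : EuclideanSpace ℝ (Fin p))
    (G : RowSpace n p) : inner ℝ (rankOneRows q w) G = inner ℝ q (rowAct w G) := by
  rw [PiLp.inner_apply, PiLp.inner_apply]
  refine Finset.sum_congr rfl fun k _ => ?_
  rw [rowAct_apply]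
  simp [rankOneRows, inner_smul_left, mul_comm]

theorem inner_rankOneRows_rankOneRows (q q' : EuclideanSpace ℝ (Fin n))
    (w w' : EuclideanSpace ℝ (Fin p)) :
    inner ℝ (rankOneRows q w) (rankOneRows q' w') = inner ℝ q q' * inner ℝ w w' := by
  rw [inner_rankOneRows, PiLp.inner_apply, PiLp.inner_apply, Finset.sum_mul]
  refine Finset.sum_congr rfl fun k _ => ?_
  rw [rowAct_apply]
  simp [rankOneRows, inner_smul_right]
  ring

theorem integral_inner_sq_stdGaussian {H : Type*} [NormedAddCommGroup H] [InnerProductSpace ℝ H]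
    [FiniteDimensional ℝ H] [MeasurableSpace H] [BorelSpace H] (a : H) :
    ∫ x, (inner ℝ a x) ^ 2 ∂(stdGaussian H) = ‖a‖ ^ 2 := by
  have h := variance_dual_stdGaussian (innerSL ℝ a)
  rw [variance_of_integral_eq_zero (by fun_prop) (isCentered_stdGaussian _),
    innerSL_apply_norm] at h
  simpa using h

variable {ι : Type*} [Fintype ι]

/-- The bilinear Gaussian process `(G wᵢ, ‖wᵢ‖ z)`. -/
noncomputable def bilinearProcess (n : ℕ) (w : ι → EuclideanSpace ℝ (Fin p)) :
    RowSpace n p × ℝ →L[ℝ] (ι → EuclideanSpace ℝ (Fin n) × ℝ) :=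
  ContinuousLinearMap.pi fun i =>
    ((rowAct (w i)).comp (ContinuousLinearMap.fst ℝ _ _)).prod
      (‖w i‖ • ContinuousLinearMap.snd ℝ _ _)

/-- The decoupled Gaussian process `(‖wᵢ‖ g, ⟨wᵢ, h⟩)`. -/
noncomputable def decoupledProcess (n : ℕ) (w : ι → EuclideanSpace ℝ (Fin p)) :
    EuclideanSpace ℝ (Fin n) × EuclideanSpace ℝ (Fin p) →L[ℝ]
      (ι → EuclideanSpace ℝ (Fin n) × ℝ) :=
  ContinuousLinearMap.pi fun i =>
    (‖w i‖ • ContinuousLinearMap.fst ℝ _ _).prod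
      ((innerSL ℝ (w i)).comp (ContinuousLinearMap.snd ℝ _ _))

/-- Law of the bilinear process. -/
noncomputable def bilinearLaw (n : ℕ) (w : ι → EuclideanSpace ℝ (Fin p)) :
    Measure (ι → EuclideanSpace ℝ (Fin n) × ℝ) :=
  ((stdGaussian (RowSpace n p)).prod (stdGaussian ℝ)).map (bilinearProcess n w)

/-- Law of the decoupled process. -/
noncomputable def decoupledLaw (n : ℕ) (w : ι → EuclideanSpace ℝ (Fin p)) :
    Measure (ι → EuclideanSpace ℝ (Fin n) × ℝ) :=
  ((stdGaussian (EuclideanSpace ℝ (Fin n))).prod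
    (stdGaussian (EuclideanSpace ℝ (Fin p)))).map (decoupledProcess n w)

instance (w : ι → EuclideanSpace ℝ (Fin p)) : IsGaussian (bilinearLaw n w) := by
  unfold bilinearLaw; infer_instance

instance (w : ι → EuclideanSpace ℝ (Fin p)) : IsGaussian (decoupledLaw n w) := by
  unfold decoupledLaw; infer_instance

theorem isCentered_bilinearLaw (w : ι → EuclideanSpace ℝ (Fin p)) :
    IsCentered (bilinearLaw n w) :=
  (isCentered_stdGaussian.prod isCentered_stdGaussian).map _

theorem isCentered_decoupledLaw (w : ι → EuclideanSpace ℝ (Fin p)) :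
    IsCentered (decoupledLaw n w) :=
  (isCentered_stdGaussian.prod isCentered_stdGaussian).map _

theorem sum_sum_inner {κ H : Type*} [Fintype κ] [NormedAddCommGroup H] [InnerProductSpace ℝ H]
    (a : κ → H) : ‖∑ i, a i‖ ^ 2 = ∑ i, ∑ j, inner ℝ (a i) (a j) := by
  rw [← real_inner_self_eq_norm_sq, sum_inner]
  simp only [inner_sum]

/-- The matrix part of L is the inner product with Σ qᵢ wᵢᵀ. The decoupled covariance differs only
by interchanging ⟨wᵢ, wⱼ⟩ and ‖wᵢ‖‖wⱼ‖, which coincide for i = j. -/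
theorem integral_sq_bilinearLaw (w : ι → EuclideanSpace ℝ (Fin p))
    (L : StrongDual ℝ (ι → EuclideanSpace ℝ (Fin n) × ℝ)) (q : ι → EuclideanSpace ℝ (Fin n))
    (r : ι → ℝ) (hL : ∀ y, L y = ∑ i, (inner ℝ (q i) (y i).1 + r i * (y i).2)) :
    ∫ y, (L y) ^ 2 ∂(bilinearLaw n w) =
      ∑ i, ∑ j, (inner ℝ (q i) (q j) * inner ℝ (w i) (w j) + r i * r j * (‖w i‖ * ‖w j‖)) := by
  rw [bilinearLaw, integral_map (by fun_prop) (by fun_prop)]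
  have e := integral_sq_prod (isCentered_stdGaussian (E := RowSpace n p))
    (isCentered_stdGaussian (E := ℝ)) (L.comp (bilinearProcess n w))
  simp only [ContinuousLinearMap.comp_apply] at e
  rw [e]
  have e1 : ∀ G, L (bilinearProcess n w (G, 0)) = inner ℝ (∑ i, rankOneRows (q i) (w i)) G := by
    intro G
    rw [hL, sum_inner]
    refine Finset.sum_congr rfl fun i _ => ?_
    rw [inner_rankOneRows]
    simp [bilinearProcess]
  have e2 : ∀ z, L (bilinearProcess n w (0, z)) = inner ℝ (∑ i, r i * ‖w i‖) z := by
    intro z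
    rw [hL, sum_inner]
    refine Finset.sum_congr rfl fun i _ => ?_
    simp [bilinearProcess]
    ring
  simp only [e1, e2]
  rw [integral_inner_sq_stdGaussian, integral_inner_sq_stdGaussian, sum_sum_inner, sum_sum_inner,
    ← Finset.sum_add_distrib]
  refine Finset.sum_congr rfl fun i _ => ?_
  rw [← Finset.sum_add_distrib]
  refine Finset.sum_congr rfl fun j _ => ?_
  rw [inner_rankOneRows_rankOneRows]
  simp
  ring

theorem integral_sq_decoupledLaw (w : ι → EuclideanSpace ℝ (Fin p))
    (L : StrongDual ℝ (ι → EuclideanSpace ℝ (Fin n) × ℝ)) (q : ι → EuclideanSpace ℝ (Fin n))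
    (r : ι → ℝ) (hL : ∀ y, L y = ∑ i, (inner ℝ (q i) (y i).1 + r i * (y i).2)) :
    ∫ y, (L y) ^ 2 ∂(decoupledLaw n w) =
      ∑ i, ∑ j, (inner ℝ (q i) (q j) * (‖w i‖ * ‖w j‖) + r i * r j * inner ℝ (w i) (w j)) := by
  rw [decoupledLaw, integral_map (by fun_prop) (by fun_prop)]
  have e := integral_sq_prod (isCentered_stdGaussian (E := EuclideanSpace ℝ (Fin n)))
    (isCentered_stdGaussian (E := EuclideanSpace ℝ (Fin p))) (L.comp (decoupledProcess n w))
  simp only [ContinuousLinearMap.comp_apply] at e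
  rw [e]
  have e1 : ∀ g, L (decoupledProcess n w (g, 0)) = inner ℝ (∑ i, ‖w i‖ • q i) g := by
    intro G
    rw [hL, sum_inner]
    refine Finset.sum_congr rfl fun i _ => ?_
    simp [decoupledProcess, inner_smul_left, inner_smul_right]
  have e2 : ∀ h, L (decoupledProcess n w (0, h)) = inner ℝ (∑ i, r i • w i) h := by
    intro z
    rw [hL, sum_inner]
    refine Finset.sum_congr rfl fun i _ => ?_
    simp [decoupledProcess, inner_smul_left]
  simp only [e1, e2]
  rw [integral_inner_sq_stdGaussian, integral_inner_sq_stdGaussian, sum_sum_inner, sum_sum_inner,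
    ← Finset.sum_add_distrib]
  refine Finset.sum_congr rfl fun i _ => ?_
  rw [← Finset.sum_add_distrib]
  refine Finset.sum_congr rfl fun j _ => ?_
  simp [inner_smul_left, inner_smul_right]
  ring

/-- The two processes have the same one-point marginals. -/
theorem map_eval_bilinearLaw (w : ι → EuclideanSpace ℝ (Fin p)) (i : ι) :
    (bilinearLaw n w).map (ContinuousLinearMap.proj (R := ℝ)
      (φ := fun _ : ι => EuclideanSpace ℝ (Fin n) × ℝ) i) =
    (decoupledLaw n w).map (ContinuousLinearMap.proj (R := ℝ)
      (φ := fun _ : ι => EuclideanSpace ℝ (Fin n) × ℝ) i) := by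
  classical
  refine ((isCentered_bilinearLaw w).map _).ext ((isCentered_decoupledLaw w).map _) fun L => ?_
  rw [integral_map (by fun_prop) (by fun_prop), integral_map (by fun_prop) (by fun_prop)]
  set q : EuclideanSpace ℝ (Fin n) := (InnerProductSpace.toDual ℝ _).symm
    (L.comp (ContinuousLinearMap.inl ℝ _ _)) with hq
  have hL : ∀ y : ι → EuclideanSpace ℝ (Fin n) × ℝ,
      (L.comp (ContinuousLinearMap.proj i)) y = ∑ j, (inner ℝ ((Pi.single i q : ι → _) j) (y j).1 +
        (Pi.single i (L (0, 1)) : ι → ℝ) j * (y j).2) := by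
    intro y
    rw [Finset.sum_eq_single i]
    · simp only [Pi.single_eq_same, ContinuousLinearMap.comp_apply, ContinuousLinearMap.proj_apply]
      have h1 : inner ℝ q (y i).1 = L ((y i).1, 0) := by
        rw [hq, InnerProductSpace.toDual_symm_apply]
        simp
      have h2 : L (0, 1) * (y i).2 = L (0, (y i).2) := by
        have : ((0 : EuclideanSpace ℝ (Fin n)), (y i).2) = (y i).2 • (0, (1 : ℝ)) := by simp
        rw [this, map_smul, smul_eq_mul, mul_comm]
      rw [h1, h2, ← map_add]
      simp
    · intro j _ hj
      simp [hj]
    · simp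
  have h1 := integral_sq_bilinearLaw w _ _ _ hL
  have h2 := integral_sq_decoupledLaw w _ _ _ hL
  simp only [ContinuousLinearMap.comp_apply] at h1 h2
  rw [h1, h2]
  refine Finset.sum_congr rfl fun j _ => Finset.sum_congr rfl fun k _ => ?_
  by_cases hj : j = i
  · by_cases hk : k = i
    · subst hj; subst hk
      rw [real_inner_self_eq_norm_sq (w _)]
      ring
    · simp [hk]
  · simp [hj]

/-- Gordon-type comparison for exponentials of sums. -/
theorem integral_exp_sum_decoupled_le (w : ι → EuclideanSpace ℝ (Fin p))
    {α : ι → EuclideanSpace ℝ (Fin n) × ℝ → ℝ}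
    {D : ι → EuclideanSpace ℝ (Fin n) × ℝ → EuclideanSpace ℝ (Fin n) × ℝ →L[ℝ] ℝ}
    {Q : ι → EuclideanSpace ℝ (Fin n) × ℝ → EuclideanSpace ℝ (Fin n) × ℝ → ℝ}
    (h : ∀ i, HasSecondJet (α i) (D i) (Q i)) {B : ℝ} (hB : ∀ i z, α i z ≤ B)
    (hD : ∀ i z, ∃ s : ℝ, 0 ≤ s ∧ ∃ v : EuclideanSpace ℝ (Fin n), ‖v‖ ≤ 1 ∧
      ∀ y, D i z y = s * (inner ℝ v y.1 + y.2)) :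
    Integrable (fun y => Real.exp (∑ i, α i (y i))) (bilinearLaw n w) ∧
    Integrable (fun y => Real.exp (∑ i, α i (y i))) (decoupledLaw n w) ∧
    ∫ y, Real.exp (∑ i, α i (y i)) ∂(decoupledLaw n w) ≤
      ∫ y, Real.exp (∑ i, α i (y i)) ∂(bilinearLaw n w) := by
  have j1 := fun i => (h i).comp_affine (ContinuousLinearMap.proj (R := ℝ)
      (φ := fun _ : ι => EuclideanSpace ℝ (Fin n) × ℝ) i) 0
  simp only [ContinuousLinearMap.proj_apply, add_zero] at j1
  have j2 := (HasSecondJet.sum Finset.univ j1).scalar_comp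
    (scalarJet_exp (∑ _ : ι, B)) (fun x => Finset.sum_le_sum fun i _ => hB i _)
  obtain ⟨C, j⟩ := j2
  refine ⟨j.integrable _, j.integrable _, ?_⟩
  have main := j.integral_le_exp_mul (fun p => (Real.exp_pos _).le) (isCentered_decoupledLaw w)
    (isCentered_bilinearLaw w) (κ := 0) le_rfl (fun x => ?_)
  · simpa using main
  · rw [mul_zero, zero_mul, add_zero]
    set e := Real.exp (∑ i, α i (x i))
    have he : 0 < e := Real.exp_pos _
    set L : (ι → EuclideanSpace ℝ (Fin n) × ℝ) →L[ℝ] ℝ :=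
      ∑ i, (D i (x i)).comp (ContinuousLinearMap.proj i) with hLdef
    have iq : ∀ (ρ : Measure (ι → EuclideanSpace ℝ (Fin n) × ℝ)) [IsGaussian ρ] (i : ι),
        Integrable (fun y => Q i (x i) (y i)) ρ := fun ρ _ i =>
      (j1 i).elim fun _ hj => hj.integrable_quad ρ x
    have split : ∀ (ρ : Measure (ι → EuclideanSpace ℝ (Fin n) × ℝ)) [IsGaussian ρ],
        ∫ y, (e * (L y) ^ 2 + e * ∑ i, Q i (x i) (y i)) ∂ρ =
          e * ∫ y, (L y) ^ 2 ∂ρ + e * ∑ i, ∫ y, Q i (x i) (y i) ∂ρ := fun ρ _ => by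
      rw [integral_add ((integrable_dual_sq ρ L).const_mul e)
        ((integrable_finsetSum _ fun i _ => iq ρ i).const_mul e), integral_const_mul,
        integral_const_mul, integral_finsetSum _ fun i _ => iq ρ i]
    rw [split, split]
    -- Each Q i sees a single coordinate, whose law is common to both processes, so only the squared
    -- gradient of the sum matters.
    have hq : ∀ i, ∫ y, Q i (x i) (y i) ∂(decoupledLaw n w) =
        ∫ y, Q i (x i) (y i) ∂(bilinearLaw n w) := fun i => by
      obtain ⟨_, hi⟩ := h i
      have hc := hi.continuous_quad (x i)
      have m : ∀ ρ : Measure (ι → EuclideanSpace ℝ (Fin n) × ℝ),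
          ∫ y, Q i (x i) (y i) ∂ρ = ∫ z, Q i (x i) z ∂(ρ.map (ContinuousLinearMap.proj (R := ℝ)
            (φ := fun _ : ι => EuclideanSpace ℝ (Fin n) × ℝ) i)) := fun ρ => by
        rw [integral_map (by fun_prop) hc.aestronglyMeasurable]
        rfl
      rw [m, m, map_eval_bilinearLaw]
    simp only [hq]
    choose s hs v hv hsv using fun i => hD i (x i)
    have hL : ∀ y, L y = ∑ i, (inner ℝ (s i • v i) (y i).1 + s i * (y i).2) := fun y => by
      simp only [hLdef, _root_.sum_apply, ContinuousLinearMap.comp_apply,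
        ContinuousLinearMap.proj_apply, hsv, inner_smul_left]
      refine Finset.sum_congr rfl fun i _ => ?_
      simp
      ring
    rw [integral_sq_bilinearLaw w L _ _ hL, integral_sq_decoupledLaw w L _ _ hL]
    gcongr e * ?_ + _
    refine Finset.sum_le_sum fun i _ => Finset.sum_le_sum fun k _ => ?_
    -- Bilinear minus decoupled is sᵢ sₖ (1 − ⟨vᵢ, vₖ⟩)(‖wᵢ‖‖wₖ‖ − ⟨wᵢ, wₖ⟩), a product of
    -- nonnegative factors.
    have a1 : inner ℝ (v i) (v k) ≤ 1 := by
      refine (real_inner_le_norm _ _).trans ?_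
      nlinarith [hv i, hv k, norm_nonneg (v i), norm_nonneg (v k)]
    have a2 := real_inner_le_norm (w i) (w k)
    have a3 := mul_nonneg (mul_nonneg (hs i) (hs k))
      (mul_nonneg (sub_nonneg.2 a1) (sub_nonneg.2 a2))
    simp only [inner_smul_left, inner_smul_right, conj_trivial]
    linarith

theorem tendsto_arctan_mul_natCast {ε : ℝ} (hε : 0 < ε) :
    Filter.Tendsto (fun m : ℕ => Real.arctan (m * ε)) Filter.atTop (nhds (Real.pi / 2)) := by
  have h1 : Filter.Tendsto (fun m : ℕ => (m : ℝ) * ε) Filter.atTop Filter.atTop :=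
    tendsto_natCast_atTop_atTop.atTop_mul_const hε
  exact (Real.tendsto_arctan_atTop.comp h1).mono_right nhdsWithin_le_nhds

/-- The smoothed comparison of probabilities. -/
theorem decoupled_le_bilinear_of_pos (w : ι → EuclideanSpace ℝ (Fin p))
    (u : ι → EuclideanSpace ℝ (Fin n)) (c : ι → ℝ) {ε : ℝ} (hε : 0 < ε) :
    (decoupledLaw n w).real {y | ∀ i, 0 ≤ ‖(y i).1 + u i‖ + (y i).2 - c i} ≤
      (bilinearLaw n w).real {y | ∀ i, -(2 * ε) < ‖(y i).1 + u i‖ + (y i).2 - c i} := by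
  set N : ℝ := (Fintype.card ι : ℝ) with hN
  set PB := (decoupledLaw n w).real {y | ∀ i, 0 ≤ ‖(y i).1 + u i‖ + (y i).2 - c i}
  set PA := (bilinearLaw n w).real {y | ∀ i, -(2 * ε) < ‖(y i).1 + u i‖ + (y i).2 - c i}
  have mA : MeasurableSet {y : ι → EuclideanSpace ℝ (Fin n) × ℝ |
      ∀ i, -(2 * ε) < ‖(y i).1 + u i‖ + (y i).2 - c i} := by
    rw [Set.ofPred_forall]
    exact MeasurableSet.iInter fun i => measurableSet_lt measurable_const (by fun_prop)
  have mB : MeasurableSet {y : ι → EuclideanSpace ℝ (Fin n) × ℝ |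
      ∀ i, 0 ≤ ‖(y i).1 + u i‖ + (y i).2 - c i} := by
    rw [Set.ofPred_forall]
    exact MeasurableSet.iInter fun i => measurableSet_le measurable_const (by fun_prop)
  -- The test function is exp(k Σ arctan(m aᵢ)). On the left event all aᵢ ≥ ε, while a single aᵢ ≤ 0
  -- costs a factor exp(−kπ/2) against the supremum; m → ∞ and then k → ∞ isolate the events. The
  -- slack 2ε is the shift ε inside aᵢ plus the smoothing error ε.
  have main : ∀ m k : ℕ, PB * Real.exp (k * (N * Real.arctan (m * ε))) ≤
      PA * Real.exp (k * (N * (Real.pi / 2))) + Real.exp (k * ((N - 1) * (Real.pi / 2))) := by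
    intro m k
    let a : ι → EuclideanSpace ℝ (Fin n) × ℝ → ℝ := fun i z =>
      smoothNorm ε (z.1 + u i) + (z.2 + (-c i + ε))
    have ja : ∀ i, HasSecondJet (a i) _ _ := fun i =>
      ((hasSecondJet_smoothNorm hε).comp_affine
        (ContinuousLinearMap.fst ℝ (EuclideanSpace ℝ (Fin n)) ℝ) (u i)).add
      (hasSecondJet_affine (ContinuousLinearMap.snd ℝ (EuclideanSpace ℝ (Fin n)) ℝ) (-c i + ε))
    have j := fun i => (((ja i).scalar_comp (scalarJet_mul_left (m : ℝ))
      (fun _ => Set.mem_univ _)).scalar_comp scalarJet_arctan (fun _ => Set.mem_univ _)).scalar_comp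
      (scalarJet_mul_left (k : ℝ)) (fun _ => Set.mem_univ _)
    have hlt : ∀ s : ℝ, (k : ℝ) * Real.arctan s ≤ k * (Real.pi / 2) := fun s =>
      mul_le_mul_of_nonneg_left (Real.arctan_lt_pi_div_two s).le (Nat.cast_nonneg k)
    obtain ⟨iA, iB, hle⟩ := integral_exp_sum_decoupled_le w j (fun i z => hlt _) (fun i z => by
      have h0 := smoothNorm_pos hε (z.1 + u i)
      refine ⟨k * (1 / (1 + (m * a i z) ^ 2) * m), by positivity,
        (smoothNorm ε (z.1 + u i))⁻¹ • (z.1 + u i), ?_, fun y => ?_⟩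
      · rw [norm_smul, norm_inv, Real.norm_of_nonneg h0.le, ← div_eq_inv_mul, div_le_one h0]
        exact le_smoothNorm _
      · simp [-smul_add, inner_smul_left, inner_add_left]
        ring)
    have low : PB * Real.exp (k * (N * Real.arctan (m * ε))) ≤
        ∫ y, Real.exp (∑ i, (k : ℝ) * Real.arctan (m * a i (y i))) ∂(decoupledLaw n w) := by
      have hsub : {y : ι → EuclideanSpace ℝ (Fin n) × ℝ |
          ∀ i, 0 ≤ ‖(y i).1 + u i‖ + (y i).2 - c i} ⊆
          {y | Real.exp (k * (N * Real.arctan (m * ε))) ≤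
            Real.exp (∑ i, (k : ℝ) * Real.arctan (m * a i (y i)))} := by
        intro y hy
        refine Real.exp_le_exp.2 ?_
        have : ∑ _ : ι, (k : ℝ) * Real.arctan (m * ε) ≤
            ∑ i, (k : ℝ) * Real.arctan (m * a i (y i)) := by
          refine Finset.sum_le_sum fun i _ => mul_le_mul_of_nonneg_left
            (Real.arctan_mono (mul_le_mul_of_nonneg_left ?_ (Nat.cast_nonneg m))) (Nat.cast_nonneg k)
          have h1 := le_smoothNorm (ε := ε) ((y i).1 + u i)
          have h2 := hy i
          simp only [a]
          linarith
        refine le_trans (le_of_eq ?_) this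
        simp [hN]
        ring
      refine le_trans ?_ (mul_meas_ge_le_integral_of_nonneg
        (Filter.Eventually.of_forall fun y => (Real.exp_pos _).le) iB
        (Real.exp (k * (N * Real.arctan (m * ε)))))
      rw [mul_comm]
      exact mul_le_mul_of_nonneg_left (measureReal_mono hsub) (Real.exp_pos _).le
    have high : ∫ y, Real.exp (∑ i, (k : ℝ) * Real.arctan (m * a i (y i))) ∂(bilinearLaw n w) ≤
        PA * Real.exp (k * (N * (Real.pi / 2))) + Real.exp (k * ((N - 1) * (Real.pi / 2))) := by
      set A := {y : ι → EuclideanSpace ℝ (Fin n) × ℝ |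
        ∀ i, -(2 * ε) < ‖(y i).1 + u i‖ + (y i).2 - c i}
      have iI : Integrable (A.indicator fun _ => Real.exp (k * (N * (Real.pi / 2))))
          (bilinearLaw n w) := (integrable_const _).indicator mA
      have : PA * Real.exp (k * (N * (Real.pi / 2))) + Real.exp (k * ((N - 1) * (Real.pi / 2))) =
          ∫ y, (A.indicator (fun _ => Real.exp (k * (N * (Real.pi / 2)))) y +
            Real.exp (k * ((N - 1) * (Real.pi / 2)))) ∂(bilinearLaw n w) := by
        rw [integral_add iI (integrable_const _), integral_indicator_const _ mA]
        rw [integral_const, probReal_univ, one_smul, smul_eq_mul]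
      rw [this]
      refine integral_mono iA (iI.add (integrable_const _)) fun y => ?_
      simp only
      by_cases hy : y ∈ A
      · rw [Set.indicator_of_mem hy]
        refine le_add_of_le_of_nonneg (Real.exp_le_exp.2 ?_) (Real.exp_pos _).le
        have : ∑ i, (k : ℝ) * Real.arctan (m * a i (y i)) ≤ ∑ _ : ι, (k : ℝ) * (Real.pi / 2) :=
          Finset.sum_le_sum fun i _ => hlt _
        refine this.trans (le_of_eq ?_)
        simp [hN]
        ring
      · rw [Set.indicator_of_notMem hy, zero_add]
        refine Real.exp_le_exp.2 ?_
        simp only [A, Set.mem_ofPred_eq, not_forall, not_lt] at hy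
        obtain ⟨i, hi⟩ := hy
        classical
        rw [← Finset.add_sum_erase _ _ (Finset.mem_univ i)]
        have h1 : (k : ℝ) * Real.arctan (m * a i (y i)) ≤ 0 := by
          refine mul_nonpos_of_nonneg_of_nonpos (Nat.cast_nonneg k) ?_
          rw [← Real.arctan_zero]
          refine Real.arctan_mono (mul_nonpos_of_nonneg_of_nonpos (Nat.cast_nonneg m) ?_)
          have := smoothNorm_le hε.le ((y i).1 + u i)
          simp only [a]
          linarith
        have h2 : ∑ l ∈ Finset.univ.erase i, (k : ℝ) * Real.arctan (m * a l (y l)) ≤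
            ∑ _ ∈ Finset.univ.erase i, (k : ℝ) * (Real.pi / 2) :=
          Finset.sum_le_sum fun l _ => hlt _
        have h3 : ∑ _ ∈ Finset.univ.erase i, (k : ℝ) * (Real.pi / 2) =
            k * ((N - 1) * (Real.pi / 2)) := by
          rw [Finset.sum_const, Finset.card_erase_of_mem (Finset.mem_univ i), nsmul_eq_mul,
            Finset.card_univ, Nat.cast_pred (Fintype.card_pos_iff.2 ⟨i⟩)]
          ring
        linarith
    exact low.trans (hle.trans high)
  have lim1 : ∀ k : ℕ, PB ≤ PA + Real.exp (-(k * (Real.pi / 2))) := by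
    intro k
    have l := (((tendsto_arctan_mul_natCast hε).const_mul N).const_mul (k : ℝ))
    have l2 := ((Real.continuous_exp.tendsto _).comp l).const_mul PB
    have := le_of_tendsto l2 (Filter.Eventually.of_forall fun m => main m k)
    have e : Real.exp (k * ((N - 1) * (Real.pi / 2))) =
        Real.exp (-(k * (Real.pi / 2))) * Real.exp (k * (N * (Real.pi / 2))) := by
      rw [← Real.exp_add]
      congr 1
      ring
    rw [e, ← add_mul] at this
    exact le_of_mul_le_mul_right this (Real.exp_pos _)
  have l3 : Filter.Tendsto (fun k : ℕ => PA + Real.exp (-(k * (Real.pi / 2)))) Filter.atTop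
      (nhds (PA + 0)) := by
    refine Filter.Tendsto.const_add _ (Real.tendsto_exp_neg_atTop_nhds_zero.comp ?_)
    exact tendsto_natCast_atTop_atTop.atTop_mul_const (by positivity)
  rw [add_zero] at l3
  exact ge_of_tendsto l3 (Filter.Eventually.of_forall lim1)

/-- Gordon's comparison for the minimum of `‖G wᵢ + uᵢ‖`. -/
theorem decoupled_le_bilinear (w : ι → EuclideanSpace ℝ (Fin p))
    (u : ι → EuclideanSpace ℝ (Fin n)) (c : ι → ℝ) :
    (decoupledLaw n w).real {y | ∀ i, 0 ≤ ‖(y i).1 + u i‖ + (y i).2 - c i} ≤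
      (bilinearLaw n w).real {y | ∀ i, 0 ≤ ‖(y i).1 + u i‖ + (y i).2 - c i} := by
  let A : ℕ → Set (ι → EuclideanSpace ℝ (Fin n) × ℝ) := fun m =>
    {y | ∀ i, -(2 * (1 / ((m : ℝ) + 1))) < ‖(y i).1 + u i‖ + (y i).2 - c i}
  have hA : {y : ι → EuclideanSpace ℝ (Fin n) × ℝ |
      ∀ i, 0 ≤ ‖(y i).1 + u i‖ + (y i).2 - c i} = ⋂ m, A m := by
    ext y
    simp only [A, Set.mem_ofPred_eq, Set.mem_iInter]
    constructor
    · intro h m i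
      have : 0 < 1 / ((m : ℝ) + 1) := by positivity
      linarith [h i]
    · intro h i
      have l : Filter.Tendsto (fun m : ℕ => -(2 * (1 / ((m : ℝ) + 1)))) Filter.atTop
          (nhds (-(2 * 0))) := (tendsto_one_div_add_atTop_nhds_zero_nat.const_mul 2).neg
      simpa using le_of_tendsto l (Filter.Eventually.of_forall fun m => (h m i).le)
  have mA : ∀ m, MeasurableSet (A m) := fun m => by
    simp only [A]
    rw [Set.ofPred_forall]
    exact MeasurableSet.iInter fun i => measurableSet_lt measurable_const (by fun_prop)
  have anti : Antitone A := fun m m' hm y hy i => by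
    refine lt_of_le_of_lt ?_ (hy i)
    have : 1 / ((m' : ℝ) + 1) ≤ 1 / ((m : ℝ) + 1) := by
      have : (m : ℝ) ≤ m' := by exact_mod_cast hm
      gcongr
    linarith
  have lim := tendsto_measure_iInter_atTop (μ := bilinearLaw n w)
    (fun m => (mA m).nullMeasurableSet) anti ⟨0, measure_ne_top _ _⟩
  have lim' : Filter.Tendsto (fun m => (bilinearLaw n w).real (A m)) Filter.atTop
      (nhds ((bilinearLaw n w).real (⋂ m, A m))) :=
    (ENNReal.tendsto_toReal (measure_ne_top _ _)).comp lim
  have key := ge_of_tendsto lim' (Filter.Eventually.of_forall fun m =>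
    decoupled_le_bilinear_of_pos w u c (ε := 1 / ((m : ℝ) + 1)) (by positivity))
  rwa [← hA] at key

end Gordon

/-! ### Concentration and comparison for the Gaussian matrix -/

section BilinearConcentration

variable {n p : ℕ} {ι : Type*} [Fintype ι]

/-- Two-copy concentration for `min (‖G wᵢ + uᵢ‖ - cᵢ)`. -/
theorem rowAct_concentration {w : ι → EuclideanSpace ℝ (Fin p)} (hw : ∀ i, ‖w i‖ ≤ 1)
    (u : ι → EuclideanSpace ℝ (Fin n)) (c : ι → ℝ) (T : ℝ) {t : ℝ} (ht : 0 ≤ t) :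
    (stdGaussian (RowSpace n p)).real {G | ∃ i, ‖rowAct (w i) G + u i‖ < c i - T} *
      (stdGaussian (RowSpace n p)).real {G | ∀ i, c i ≤ ‖rowAct (w i) G + u i‖} ≤
      Real.exp (t ^ 2 - t * T) := by
  have main : ∀ m : ℕ, (stdGaussian (RowSpace n p)).real
        {G | ∃ i, ‖rowAct (w i) G + u i‖ < c i - T} *
      (stdGaussian (RowSpace n p)).real {G | ∀ i, c i ≤ ‖rowAct (w i) G + u i‖} ≤
      Real.exp (t ^ 2 - t * (T - 1 / ((m : ℝ) + 1))) := by
    intro m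
    set ε : ℝ := 1 / ((m : ℝ) + 1)
    have hε : 0 < ε := by positivity
    have j := fun i => ((hasSecondJet_smoothNorm (F := EuclideanSpace ℝ (Fin n)) hε).comp_affine
      (rowAct (w i) : RowSpace n p →L[ℝ] _) (u i)).add (hasSecondJet_affine 0 (-c i))
    have key := two_copy_concentration (isCentered_stdGaussian (E := RowSpace n p)) j
      (fun i G => ?_) (T - ε) ht
    · refine le_trans (mul_le_mul (measureReal_mono ?_) (measureReal_mono ?_) measureReal_nonneg
        measureReal_nonneg) key
      · rintro G ⟨i, hi⟩
        refine ⟨i, ?_⟩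
        have := smoothNorm_le hε.le (rowAct (w i) G + u i)
        simp only [zero_apply, zero_add]
        linarith
      · intro G hG i
        have := le_smoothNorm (ε := ε) (rowAct (w i) G + u i)
        have := hG i
        simp only [zero_apply, zero_add]
        linarith
    · set x := rowAct (w i) G + u i
      have hx := smoothNorm_pos hε x
      -- The gradient in G is the rank one matrix q wᵢᵀ, whose Hilbert norm is ‖q‖‖wᵢ‖ ≤ 1.
      set q := (smoothNorm ε x)⁻¹ • x with hq
      have hq1 : ‖q‖ ≤ 1 := by
        rw [hq, norm_smul, norm_inv, Real.norm_of_nonneg hx.le, ← div_eq_inv_mul, div_le_one hx]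
        exact le_smoothNorm _
      have e : ∀ z, ((((smoothNorm ε x)⁻¹ • innerSL ℝ x).comp (rowAct (w i)) +
          (0 : RowSpace n p →L[ℝ] ℝ)) z) ^ 2 = (inner ℝ (rankOneRows q (w i)) z) ^ 2 := fun z => by
        rw [inner_rankOneRows, hq, real_inner_smul_left]
        simp
      simp only [e]
      rw [integral_inner_sq_stdGaussian, ← real_inner_self_eq_norm_sq,
        inner_rankOneRows_rankOneRows, real_inner_self_eq_norm_sq, real_inner_self_eq_norm_sq]
      have h1 : ‖q‖ ^ 2 ≤ 1 := pow_le_one₀ (norm_nonneg _) hq1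
      have h2 : ‖w i‖ ^ 2 ≤ 1 := pow_le_one₀ (norm_nonneg _) (hw i)
      exact mul_le_one₀ h1 (sq_nonneg _) h2
  have l : Filter.Tendsto (fun m : ℕ => Real.exp (t ^ 2 - t * (T - 1 / ((m : ℝ) + 1))))
      Filter.atTop (nhds (Real.exp (t ^ 2 - t * (T - 0)))) :=
    (Real.continuous_exp.tendsto _).comp (((tendsto_one_div_add_atTop_nhds_zero_nat.const_sub
      T).const_mul t).const_sub _)
  rw [sub_zero] at l
  exact ge_of_tendsto l (Filter.Eventually.of_forall main)

theorem half_le_stdGaussian_nonpos : 1 / 2 ≤ (stdGaussian ℝ).real {z | z ≤ 0} := by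
  have h1 : (stdGaussian ℝ).real {z | 0 ≤ z} = (stdGaussian ℝ).real {z | z ≤ 0} := by
    have := stdGaussian_map (E := ℝ) (LinearIsometryEquiv.neg ℝ)
    conv_lhs => rw [← this]
    rw [map_measureReal_apply (f := ⇑(LinearIsometryEquiv.neg ℝ)) (by fun_prop)
      (show MeasurableSet {z : ℝ | 0 ≤ z} from measurableSet_Ici)]
    congr 1
    ext z
    simp
  have h2 : (stdGaussian ℝ).real ({z | z ≤ 0} ∪ {z | 0 ≤ z}) = 1 := by
    have : ({z | z ≤ 0} ∪ {z | 0 ≤ z} : Set ℝ) = Set.univ :=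
      Set.eq_univ_of_forall fun z => le_total z 0
    rw [this, probReal_univ]
  have h3 := measureReal_union_le (μ := stdGaussian ℝ) {z | z ≤ 0} {z | 0 ≤ z}
  linarith

/-- Gordon's comparison as a bound on the probability that some `‖G wᵢ + uᵢ‖` is small. -/
theorem rowAct_lt_le_two_mul (w : ι → EuclideanSpace ℝ (Fin p))
    (u : ι → EuclideanSpace ℝ (Fin n)) (c : ι → ℝ) :
    (stdGaussian (RowSpace n p)).real {G | ∃ i, ‖rowAct (w i) G + u i‖ < c i} ≤
      2 * ((stdGaussian (EuclideanSpace ℝ (Fin n))).prod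
        (stdGaussian (EuclideanSpace ℝ (Fin p)))).real
        {q | ∃ i, ‖‖w i‖ • q.1 + u i‖ + inner ℝ (w i) q.2 < c i} := by
  set A : Set (ι → EuclideanSpace ℝ (Fin n) × ℝ) :=
    {y | ∀ i, 0 ≤ ‖(y i).1 + u i‖ + (y i).2 - c i} with hA
  have mA : MeasurableSet A := by
    rw [hA, Set.ofPred_forall]
    exact MeasurableSet.iInter fun i => measurableSet_le measurable_const (by fun_prop)
  have key := decoupled_le_bilinear (n := n) w u c
  have h1 := probReal_compl_eq_one_sub (μ := decoupledLaw n w) mA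
  have h2 := probReal_compl_eq_one_sub (μ := bilinearLaw n w) mA
  have h3 : (bilinearLaw n w).real Aᶜ ≤ (decoupledLaw n w).real Aᶜ := by
    rw [h1, h2]; linarith
  rw [bilinearLaw, decoupledLaw, map_measureReal_apply (by fun_prop) mA.compl,
    map_measureReal_apply (by fun_prop) mA.compl] at h3
  have e1 : decoupledProcess n w ⁻¹' Aᶜ =
      {q | ∃ i, ‖‖w i‖ • q.1 + u i‖ + inner ℝ (w i) q.2 < c i} := by
    ext q
    simp [hA, decoupledProcess, sub_nonneg]
  -- When z ≤ 0 the auxiliary term ‖wᵢ‖ z only lowers the process. As z is independent of G and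
  -- nonpositive with probability at least 1/2, discarding it costs the factor 2.
  have e2 : {G : RowSpace n p | ∃ i, ‖rowAct (w i) G + u i‖ < c i} ×ˢ {z : ℝ | z ≤ 0} ⊆
      bilinearProcess n w ⁻¹' Aᶜ := by
    rintro ⟨G, z⟩ ⟨⟨i, hi⟩, hz⟩ hmem
    have h := hmem i
    have hz' : z ≤ 0 := hz
    have h' : 0 ≤ ‖rowAct (w i) G + u i‖ + ‖w i‖ * z - c i := h
    have := mul_nonpos_of_nonneg_of_nonpos (norm_nonneg (w i)) hz'
    have hi' : ‖rowAct (w i) G + u i‖ < c i := hi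
    linarith
  have h4 := measureReal_mono (μ := (stdGaussian (RowSpace n p)).prod (stdGaussian ℝ)) e2
  rw [measureReal_prod_prod] at h4
  rw [e1] at h3
  have h5 := half_le_stdGaussian_nonpos
  have h6 : 0 ≤ (stdGaussian (RowSpace n p)).real {G | ∃ i, ‖rowAct (w i) G + u i‖ < c i} :=
    measureReal_nonneg
  nlinarith

end BilinearConcentration

/-! ### Gaussian widths, peeling and the chi-square tail -/

section Width

variable {m : ℕ}

/-- The support function of a set. -/
noncomputable def suppFun (B : Set (EuclideanSpace ℝ (Fin m))) (ξ : EuclideanSpace ℝ (Fin m)) : ℝ :=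
  sSup ((fun b => inner ℝ b ξ) '' B)

theorem gaussianWidth_eq (B : Set (EuclideanSpace ℝ (Fin m))) :
    gaussianWidth B = ∫ ξ, suppFun B ξ ∂(stdGaussian (EuclideanSpace ℝ (Fin m))) := rfl

variable {B B' : Set (EuclideanSpace ℝ (Fin m))} {R : ℝ}

theorem bddAbove_inner (hB : ∀ b ∈ B, ‖b‖ ≤ R) (ξ : EuclideanSpace ℝ (Fin m)) :
    BddAbove ((fun b => inner ℝ b ξ) '' B) := by
  refine ⟨R * ‖ξ‖, ?_⟩
  rintro _ ⟨b, hb, rfl⟩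
  exact (real_inner_le_norm _ _).trans (by gcongr; exact hB b hb)

theorem inner_le_suppFun (hB : ∀ b ∈ B, ‖b‖ ≤ R) {b : EuclideanSpace ℝ (Fin m)} (hb : b ∈ B)
    (ξ : EuclideanSpace ℝ (Fin m)) : inner ℝ b ξ ≤ suppFun B ξ :=
  le_csSup (bddAbove_inner hB ξ) ⟨b, hb, rfl⟩

theorem suppFun_le (hne : B.Nonempty) {ξ : EuclideanSpace ℝ (Fin m)} {a : ℝ}
    (h : ∀ b ∈ B, inner ℝ b ξ ≤ a) : suppFun B ξ ≤ a := by
  refine csSup_le (hne.image _) ?_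
  rintro _ ⟨b, hb, rfl⟩
  exact h b hb

theorem suppFun_nonneg (hB : ∀ b ∈ B, ‖b‖ ≤ R) (h0 : 0 ∈ B) (ξ : EuclideanSpace ℝ (Fin m)) :
    0 ≤ suppFun B ξ := by
  simpa using inner_le_suppFun hB h0 ξ

theorem continuous_suppFun (hB : ∀ b ∈ B, ‖b‖ ≤ R) (h0 : 0 ∈ B) : Continuous (suppFun B) := by
  have hR : 0 ≤ R := (norm_nonneg _).trans (hB 0 h0)
  have key : ∀ x y, suppFun B x ≤ suppFun B y + R * dist x y := by
    intro x y
    refine suppFun_le ⟨0, h0⟩ fun b hb => ?_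
    have h1 := inner_le_suppFun hB hb y
    have h2 : inner ℝ b (x - y) ≤ R * ‖x - y‖ :=
      (real_inner_le_norm _ _).trans (by gcongr; exact hB b hb)
    rw [inner_sub_right] at h2
    rw [dist_eq_norm]
    linarith
  have : LipschitzWith R.toNNReal (suppFun B) := by
    refine LipschitzWith.of_le_add_mul _ fun x y => ?_
    rw [Real.coe_toNNReal _ hR]
    exact key x y
  exact this.continuous

theorem integrable_suppFun (hB : ∀ b ∈ B, ‖b‖ ≤ R) (h0 : 0 ∈ B) :
    Integrable (suppFun B) (stdGaussian (EuclideanSpace ℝ (Fin m))) := by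
  have hi : Integrable (fun ξ : EuclideanSpace ℝ (Fin m) => R * ‖ξ‖)
      (stdGaussian (EuclideanSpace ℝ (Fin m))) := by
    simpa using (integrable_norm_pow (stdGaussian (EuclideanSpace ℝ (Fin m))) 1).const_mul R
  refine hi.mono' (continuous_suppFun hB h0).aestronglyMeasurable
    (Filter.Eventually.of_forall fun ξ => ?_)
  rw [Real.norm_of_nonneg (suppFun_nonneg hB h0 ξ)]
  exact suppFun_le ⟨0, h0⟩ fun b hb => (real_inner_le_norm _ _).trans (by gcongr; exact hB b hb)

theorem gaussianWidth_nonneg (hB : ∀ b ∈ B, ‖b‖ ≤ R) (h0 : 0 ∈ B) : 0 ≤ gaussianWidth B :=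
  integral_nonneg fun ξ => suppFun_nonneg hB h0 ξ

theorem gaussianWidth_mono (hB : ∀ b ∈ B', ‖b‖ ≤ R) (h0 : 0 ∈ B) (h : B ⊆ B') :
    gaussianWidth B ≤ gaussianWidth B' :=
  integral_mono (integrable_suppFun (fun b hb => hB b (h hb)) h0) (integrable_suppFun hB (h h0))
    fun ξ => suppFun_le ⟨0, h0⟩ fun _ hb => inner_le_suppFun hB (h hb) ξ

theorem gaussianWidth_smul {c : ℝ} (hc : 0 ≤ c) :
    gaussianWidth (c • B) = c * gaussianWidth B := by
  rw [gaussianWidth_eq, gaussianWidth_eq, ← integral_const_mul]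
  congr 1
  ext ξ
  have : (fun b => inner ℝ b ξ) '' (c • B) = c • ((fun b => inner ℝ b ξ) '' B) := by
    rw [← Set.image_smul, ← Set.image_smul, Set.image_image, Set.image_image]
    simp [inner_smul_left]
  rw [suppFun, this, Real.sSup_smul_of_nonneg hc]
  rfl

/-- Markov's inequality for the support function. -/
theorem measureReal_lt_suppFun_le (hB : ∀ b ∈ B, ‖b‖ ≤ R) (h0 : 0 ∈ B) {κ : ℝ} (hκ : 0 < κ) :
    (stdGaussian (EuclideanSpace ℝ (Fin m))).real {ξ | κ * gaussianWidth B < suppFun B ξ} ≤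
      1 / κ := by
  have hnn := fun ξ => suppFun_nonneg hB h0 ξ
  have hint := integrable_suppFun hB h0
  -- At width zero the Markov quotient degenerates, but then the nonnegative support function
  -- vanishes almost surely.
  rcases (gaussianWidth_nonneg hB h0).eq_or_lt with hz | hpos
  · have hz' : ∫ ξ, suppFun B ξ ∂(stdGaussian (EuclideanSpace ℝ (Fin m))) = 0 := hz.symm
    have hae := (integral_eq_zero_iff_of_nonneg hnn hint).1 hz'
    have : (stdGaussian (EuclideanSpace ℝ (Fin m))).real
        {ξ | κ * gaussianWidth B < suppFun B ξ} = 0 := by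
      rw [measureReal_def, measure_eq_zero_iff_ae_notMem.2, ENNReal.toReal_zero]
      filter_upwards [hae] with ξ hξ
      simp [← hz, hξ]
    rw [this]
    positivity
  · have := mul_meas_ge_le_integral_of_nonneg (Filter.Eventually.of_forall hnn) hint
      (κ * gaussianWidth B)
    have h2 := measureReal_mono (μ := stdGaussian (EuclideanSpace ℝ (Fin m)))
      (show {ξ | κ * gaussianWidth B < suppFun B ξ} ⊆
        {ξ | κ * gaussianWidth B ≤ suppFun B ξ} from Set.ofPred_subset_ofPred.2 fun ξ hξ => hξ.le)
    refine h2.trans ?_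
    rw [← gaussianWidth_eq, mul_assoc, mul_comm, mul_assoc] at this
    rw [le_div_iff₀ hκ]
    have h3 := le_of_mul_le_mul_left (this.trans_eq (mul_one _).symm) hpos
    linarith

theorem l1norm_nonneg (x : EuclideanSpace ℝ (Fin m)) : 0 ≤ l1norm x :=
  Finset.sum_nonneg fun _ _ => abs_nonneg _

theorem norm_le_l1norm (x : EuclideanSpace ℝ (Fin m)) : ‖x‖ ≤ l1norm x := by
  refine le_of_sq_le_sq ?_ (l1norm_nonneg x)
  rw [EuclideanSpace.real_norm_sq_eq, l1norm]
  have := Finset.sum_sq_le_sq_sum_of_nonneg (s := Finset.univ) (f := fun i => |x i|)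
    (fun i _ => abs_nonneg _)
  simpa using this

theorem l1norm_smul (c : ℝ) (x : EuclideanSpace ℝ (Fin m)) : l1norm (c • x) = |c| * l1norm x := by
  simp [l1norm, abs_mul, Finset.mul_sum]

theorem l1norm_neg (x : EuclideanSpace ℝ (Fin m)) : l1norm (-x) = l1norm x := by
  simp [l1norm]

theorem continuous_l1norm : Continuous (l1norm (m := m)) := by
  unfold l1norm
  fun_prop

theorem eq_zero_of_l1norm_eq_zero {x : EuclideanSpace ℝ (Fin m)} (h : l1norm x = 0) : x = 0 :=
  norm_le_zero_iff.1 (h ▸ norm_le_l1norm x)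

theorem zero_mem_l1Ball : (0 : EuclideanSpace ℝ (Fin m)) ∈ l1Ball m := by
  simp [l1Ball, l1norm]

theorem mem_l1Ball {x : EuclideanSpace ℝ (Fin m)} : x ∈ l1Ball m ↔ l1norm x ≤ 1 := Iff.rfl

theorem mem_smul_l1Ball {a : ℝ} (ha : 0 ≤ a) {x : EuclideanSpace ℝ (Fin m)} :
    x ∈ a • l1Ball m ↔ l1norm x ≤ a := by
  constructor
  · rintro ⟨y, hy, rfl⟩
    simp only [l1norm_smul, abs_of_nonneg ha]
    exact mul_le_of_le_one_right ha hy
  · intro h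
    rcases ha.eq_or_lt with rfl | hpos
    · rw [eq_zero_of_l1norm_eq_zero (le_antisymm h (l1norm_nonneg x))]
      exact ⟨0, zero_mem_l1Ball, by simp⟩
    · refine ⟨a⁻¹ • x, ?_, by simp [smul_smul, hpos.ne']⟩
      rw [mem_l1Ball, l1norm_smul, abs_of_pos (inv_pos.2 hpos), inv_mul_le_iff₀ hpos]
      simpa using h

theorem mem_smul_l2Ball {a : ℝ} (ha : 0 ≤ a) {x : EuclideanSpace ℝ (Fin m)} :
    x ∈ a • l2Ball m ↔ ‖x‖ ≤ a := by
  rw [l2Ball, smul_unitClosedBall, Real.norm_of_nonneg ha, mem_closedBall_zero_iff]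

/-- The set `‖u‖₁ 𝔹₁ ∩ ‖u‖₂ 𝔹₂`. -/
def crossBall (u : EuclideanSpace ℝ (Fin m)) : Set (EuclideanSpace ℝ (Fin m)) :=
  l1norm u • l1Ball m ∩ ‖u‖ • l2Ball m

theorem mem_crossBall {u x : EuclideanSpace ℝ (Fin m)} :
    x ∈ crossBall u ↔ l1norm x ≤ l1norm u ∧ ‖x‖ ≤ ‖u‖ := by
  rw [crossBall, Set.mem_inter_iff, mem_smul_l1Ball (l1norm_nonneg u),
    mem_smul_l2Ball (norm_nonneg u)]

theorem zero_mem_crossBall (u : EuclideanSpace ℝ (Fin m)) : 0 ∈ crossBall u := by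
  rw [mem_crossBall]
  exact ⟨by simpa [l1norm] using l1norm_nonneg u, by simp⟩

theorem norm_le_of_mem_crossBall (u : EuclideanSpace ℝ (Fin m)) :
    ∀ b ∈ crossBall u, ‖b‖ ≤ ‖u‖ := fun _ hb => (mem_crossBall.1 hb).2

theorem crossBall_smul {c : ℝ} (hc : 0 < c) (u : EuclideanSpace ℝ (Fin m)) :
    crossBall (c • u) = c • crossBall u := by
  ext x
  rw [Set.mem_smul_set_iff_inv_smul_mem₀ hc.ne', mem_crossBall, mem_crossBall, l1norm_smul,
    l1norm_smul, norm_smul, norm_smul, norm_inv, Real.norm_of_nonneg hc.le, abs_inv,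
    abs_of_pos hc, inv_mul_le_iff₀ hc, inv_mul_le_iff₀ hc]

theorem gaussianWidth_crossBall_nonneg (u : EuclideanSpace ℝ (Fin m)) :
    0 ≤ gaussianWidth (crossBall u) :=
  gaussianWidth_nonneg (norm_le_of_mem_crossBall u) (zero_mem_crossBall u)

theorem gaussianWidth_crossBall_smul {c : ℝ} (hc : 0 < c) (u : EuclideanSpace ℝ (Fin m)) :
    gaussianWidth (crossBall (c • u)) = c * gaussianWidth (crossBall u) := by
  rw [crossBall_smul hc, gaussianWidth_smul hc.le]

variable {ι : Type*} [Fintype ι]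

/-- Deviation bound for `⟨uᵢ, g⟩` over unit vectors of bounded cross width. -/
theorem measureReal_inner_lt_le (u : ι → EuclideanSpace ℝ (Fin m)) (hu : ∀ i, ‖u i‖ = 1) {K : ℝ}
    (hK : ∀ i, gaussianWidth (crossBall (u i)) ≤ K) (s : ℝ) {t : ℝ} (ht : 0 ≤ t) :
    (stdGaussian (EuclideanSpace ℝ (Fin m))).real
      {g | ∃ i, inner ℝ (u i) g < -(1.1 * K) - s} ≤ 11 * Real.exp (t ^ 2 - t * s) := by
  rcases isEmpty_or_nonempty ι with hι | hι
  · simp; positivity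
  -- For unit vectors, the cross ball of the one with largest ℓ₁-norm contains every −uᵢ, so a
  -- single support function controls all inner products. Markov at level 1.1 keeps probability 1/11
  -- for the good event, hence the factor 11 after concentration.
  obtain ⟨k, hk⟩ := Finite.exists_max fun i => l1norm (u i)
  have j := fun i => hasSecondJet_affine (innerSL ℝ (u i)) (1.1 * K)
  have key := two_copy_concentration (isCentered_stdGaussian (E := EuclideanSpace ℝ (Fin m))) j
    (fun i _ => by
      simp only [innerSL_apply_apply]
      rw [integral_inner_sq_stdGaussian, hu]
      norm_num) s ht
  simp only [innerSL_apply_apply] at key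
  have hB := norm_le_of_mem_crossBall (u k)
  have h0 := zero_mem_crossBall (u k)
  have mk := measureReal_lt_suppFun_le hB h0 (κ := 1.1) (by norm_num)
  have meas : MeasurableSet {ξ | 1.1 * gaussianWidth (crossBall (u k)) <
      suppFun (crossBall (u k)) ξ} :=
    measurableSet_lt measurable_const (continuous_suppFun hB h0).measurable
  have hc := probReal_compl_eq_one_sub (μ := stdGaussian (EuclideanSpace ℝ (Fin m))) meas
  have sub : {ξ | 1.1 * gaussianWidth (crossBall (u k)) < suppFun (crossBall (u k)) ξ}ᶜ ⊆
      {x | ∀ i, 0 ≤ inner ℝ (u i) x + 1.1 * K} := by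
    intro x hx i
    have hx' : suppFun (crossBall (u k)) x ≤ 1.1 * gaussianWidth (crossBall (u k)) := not_lt.1 hx
    have hmem : -u i ∈ crossBall (u k) := by
      rw [mem_crossBall, l1norm_neg, norm_neg, hu, hu]
      exact ⟨hk i, le_rfl⟩
    have h1 := inner_le_suppFun hB hmem x
    rw [inner_neg_left] at h1
    have h2 := hK k
    linarith
  have h3 := measureReal_mono (μ := stdGaussian (EuclideanSpace ℝ (Fin m))) sub
  have e : {g : EuclideanSpace ℝ (Fin m) | ∃ i, inner ℝ (u i) g < -(1.1 * K) - s} =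
      {x | ∃ i, inner ℝ (u i) x + 1.1 * K < -s} := by
    ext x
    refine exists_congr fun i => ⟨fun h => by linarith, fun h => by linarith⟩
  rw [e]
  have h4 : 1 / 11 ≤ (stdGaussian (EuclideanSpace ℝ (Fin m))).real
      {x | ∀ i, 0 ≤ inner ℝ (u i) x + 1.1 * K} := by
    norm_num at mk
    linarith
  have h5 : 0 ≤ (stdGaussian (EuclideanSpace ℝ (Fin m))).real
      {x | ∃ i, inner ℝ (u i) x + 1.1 * K < -s} := measureReal_nonneg
  nlinarith

theorem exp_neg_three_tenths_le : Real.exp (-(3 / 10)) ≤ 10 / 13 := by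
  rw [Real.exp_neg, inv_le_comm₀ (Real.exp_pos _) (by norm_num)]
  have := Real.add_one_le_exp (3 / 10 : ℝ)
  norm_num at this ⊢
  linarith

theorem exp_neg_nat_le (k : ℕ) : Real.exp (-(k : ℝ)) ≤ 0.37 ^ k := by
  have h1 : Real.exp (-1) ≤ 0.37 := by
    rw [Real.exp_neg, inv_le_comm₀ (Real.exp_pos _) (by norm_num)]
    have := Real.exp_one_gt_d9
    norm_num at this ⊢
    linarith
  have h2 : Real.exp (-(k : ℝ)) = Real.exp (-1) ^ k := by
    rw [← Real.exp_nat_mul]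
    congr 1
    ring
  rw [h2]
  exact pow_le_pow_left₀ (Real.exp_pos _).le h1 k

/-- Peeling: `-⟨uᵢ, g⟩` is controlled by the cross width simultaneously for all `i`. -/
theorem measureReal_peeling_le (u : ι → EuclideanSpace ℝ (Fin m)) :
    (stdGaussian (EuclideanSpace ℝ (Fin m))).real
      {g | ∃ i, 1.2 * gaussianWidth (crossBall (u i)) + 7 * ‖u i‖ < -inner ℝ (u i) g} ≤ 0.017 := by
  classical
  -- The normalized vectors are sorted by k = ⌊W⌋. In slice k the levels are chosen so that 1.1(k +
  -- 1) + 5.9 + 0.1k = 1.2k + 7 ≤ 1.2W + 7.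
  let W : ι → ℝ := fun i => gaussianWidth (crossBall (‖u i‖⁻¹ • u i))
  let Sk : ℕ → Set (EuclideanSpace ℝ (Fin m)) := fun k =>
    {g | ∃ i : {i : ι // u i ≠ 0 ∧ ⌊W i⌋₊ = k},
      inner ℝ (‖u i‖⁻¹ • u i) g < -(1.1 * (k + 1 : ℝ)) - (5.9 + 0.1 * k)}
  obtain ⟨N, hN⟩ : ∃ N, ∀ i, ⌊W i⌋₊ < N :=
    ⟨(Finset.univ.sup fun i => ⌊W i⌋₊) + 1, fun i =>
      Nat.lt_succ_of_le (Finset.le_sup (f := fun i => ⌊W i⌋₊) (Finset.mem_univ i))⟩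
  have sub : {g | ∃ i, 1.2 * gaussianWidth (crossBall (u i)) + 7 * ‖u i‖ < -inner ℝ (u i) g} ⊆
      ⋃ k ∈ Finset.range N, Sk k := by
    rintro g ⟨i, hi⟩
    have hne : u i ≠ 0 := by
      rintro h0
      rw [h0] at hi
      have := gaussianWidth_crossBall_nonneg (0 : EuclideanSpace ℝ (Fin m))
      simp at hi
      linarith
    have hpos : 0 < ‖u i‖ := norm_pos_iff.2 hne
    refine Set.mem_iUnion₂.2 ⟨⌊W i⌋₊, Finset.mem_range.2 (hN i), ⟨i, hne, rfl⟩, ?_⟩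
    have hW : W i = ‖u i‖⁻¹ * gaussianWidth (crossBall (u i)) :=
      gaussianWidth_crossBall_smul (inv_pos.2 hpos) (u i)
    have hW0 : 0 ≤ W i := gaussianWidth_crossBall_nonneg _
    have hfl := Nat.floor_le hW0
    have h1 := mul_lt_mul_of_pos_left hi (inv_pos.2 hpos)
    rw [mul_add, mul_left_comm, ← hW, mul_left_comm, inv_mul_cancel₀ hpos.ne', mul_neg,
      ← real_inner_smul_left] at h1
    simp only
    linarith
  -- With t = 3 the exponent is 9 − 17.7 − 0.3k ≤ −8 − 0.3k, and exp(−0.3) ≤ 10/13 gives a geometric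
  -- series of sum at most 13/3.
  have bound : ∀ k : ℕ, (stdGaussian (EuclideanSpace ℝ (Fin m))).real (Sk k) ≤
      11 * Real.exp (-8) * (10 / 13) ^ k := by
    intro k
    have h1 := measureReal_inner_lt_le
      (fun i : {i : ι // u i ≠ 0 ∧ ⌊W i⌋₊ = k} => ‖u i‖⁻¹ • u i) (fun i => by
        rw [norm_smul, norm_inv, norm_norm, inv_mul_cancel₀ (norm_ne_zero_iff.2 i.2.1)])
      (K := k + 1) (fun i => by
        have := Nat.lt_floor_add_one (W i)
        rw [i.2.2] at this
        exact this.le) (5.9 + 0.1 * k) (t := 3) (by norm_num)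
    refine h1.trans ?_
    rw [mul_assoc]
    refine mul_le_mul_of_nonneg_left ?_ (by norm_num)
    have e : Real.exp (-(3 / 10)) ^ k = Real.exp (-(3 / 10) * k) := by
      rw [← Real.exp_nat_mul]
      congr 1
      ring
    calc Real.exp (3 ^ 2 - 3 * (5.9 + 0.1 * k)) ≤ Real.exp (-8 + -(3 / 10) * k) :=
          Real.exp_le_exp.2 (by linarith)
      _ = Real.exp (-8) * Real.exp (-(3 / 10)) ^ k := by rw [Real.exp_add, e]
      _ ≤ _ := by
          gcongr
          exact exp_neg_three_tenths_le
  calc _ ≤ (stdGaussian (EuclideanSpace ℝ (Fin m))).real (⋃ k ∈ Finset.range N, Sk k) :=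
        measureReal_mono sub (measure_ne_top _ _)
    _ ≤ ∑ k ∈ Finset.range N, (stdGaussian (EuclideanSpace ℝ (Fin m))).real (Sk k) :=
        measureReal_biUnion_finset_le _ _
    _ ≤ ∑ k ∈ Finset.range N, 11 * Real.exp (-8) * (10 / 13) ^ k :=
        Finset.sum_le_sum fun k _ => bound k
    _ = 11 * Real.exp (-8) * ∑ k ∈ Finset.range N, (10 / 13 : ℝ) ^ k := by
        rw [Finset.mul_sum]
    _ ≤ 11 * (0.37 ^ 8) * (13 / 3) := by
        have h8 := exp_neg_nat_le 8
        have hg : ∑ k ∈ Finset.range N, (10 / 13 : ℝ) ^ k ≤ 13 / 3 := by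
          rw [geom_sum_eq (by norm_num)]
          have : 0 ≤ (10 / 13 : ℝ) ^ N := by positivity
          rw [div_le_iff_of_neg (by norm_num)]
          linarith
        have hg0 : 0 ≤ ∑ k ∈ Finset.range N, (10 / 13 : ℝ) ^ k :=
          Finset.sum_nonneg fun _ _ => by positivity
        exact mul_le_mul (mul_le_mul_of_nonneg_left h8 (by norm_num)) hg hg0 (by norm_num)
    _ ≤ 0.017 := by norm_num

theorem integral_exp_neg_sq_gaussianReal {s : ℝ} (hs : 0 ≤ s) :
    ∫ x, Real.exp (-s * x ^ 2) ∂(gaussianReal 0 1) = (√(1 + 2 * s))⁻¹ := by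
  rw [integral_gaussianReal_eq_integral_smul one_ne_zero]
  have e : ∀ x : ℝ, gaussianPDFReal 0 1 x • Real.exp (-s * x ^ 2) =
      (√(2 * Real.pi))⁻¹ * Real.exp (-(s + 1 / 2) * x ^ 2) := fun x => by
    rw [gaussianPDFReal, smul_eq_mul, mul_assoc, ← Real.exp_add]
    simp only [NNReal.coe_one, mul_one, sub_zero]
    congr 2
    ring
  simp only [e]
  rw [integral_const_mul, integral_gaussian, ← Real.sqrt_inv, ← Real.sqrt_inv,
    ← Real.sqrt_mul (by positivity)]
  congr 1
  have := Real.pi_pos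
  field_simp
  ring

theorem integral_exp_neg_norm_sq {s : ℝ} (hs : 0 ≤ s) :
    ∫ x, Real.exp (-s * ‖x‖ ^ 2) ∂(stdGaussian (EuclideanSpace ℝ (Fin m))) =
      (√(1 + 2 * s))⁻¹ ^ m := by
  rw [← map_pi_eq_stdGaussian, integral_map (by fun_prop)
    (by refine Continuous.aestronglyMeasurable ?_; fun_prop)]
  simp only [EuclideanSpace.real_norm_sq_eq, Finset.mul_sum, Real.exp_sum]
  rw [integral_fintype_prod_eq_prod (f := fun _ x => Real.exp (-s * x ^ 2))]
  rw [integral_exp_neg_sq_gaussianReal hs, Finset.prod_const, Finset.card_univ, Fintype.card_fin]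

/-- Lower tail of the chi-square distribution. -/
theorem measureReal_norm_sq_lt_le (hm : 0 < m) :
    (stdGaussian (EuclideanSpace ℝ (Fin m))).real {g | ‖g‖ ^ 2 < m - 4 * √(m : ℝ)} ≤ 0.019 := by
  have hm' : (0 : ℝ) < m := by exact_mod_cast hm
  set x := √(m : ℝ) with hx
  have hx0 : 0 < x := Real.sqrt_pos.2 hm'
  have hx2 : x ^ 2 = m := Real.sq_sqrt hm'.le
  -- With (1 + 2s)^{-1/2} ≤ exp(−s + s²), the exponent of the Laplace bound is −4sx + s²x², minimal
  -- at sx = 2 with value −4.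
  set s := 2 / x with hs
  have hs0 : 0 < s := by positivity
  have hsx : s * x = 2 := by rw [hs]; field_simp
  have hint : Integrable (fun g => Real.exp (-s * ‖g‖ ^ 2))
      (stdGaussian (EuclideanSpace ℝ (Fin m))) := by
    refine (integrable_const (1 : ℝ)).mono'
      (Continuous.aestronglyMeasurable (by fun_prop)) (Filter.Eventually.of_forall fun g => ?_)
    rw [Real.norm_of_nonneg (Real.exp_pos _).le]
    refine Real.exp_le_one_iff.2 ?_
    have : 0 ≤ s * ‖g‖ ^ 2 := by positivity
    linarith
  have mk := mul_meas_ge_le_integral_of_nonneg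
    (Filter.Eventually.of_forall fun g : EuclideanSpace ℝ (Fin m) =>
      (Real.exp_pos (-s * ‖g‖ ^ 2)).le) hint (Real.exp (-s * (m - 4 * x)))
  have sub : {g : EuclideanSpace ℝ (Fin m) | ‖g‖ ^ 2 < m - 4 * x} ⊆
      {g | Real.exp (-s * (m - 4 * x)) ≤ Real.exp (-s * ‖g‖ ^ 2)} := fun g hg =>
    Real.exp_le_exp.2 (by
      have : ‖g‖ ^ 2 < m - 4 * x := hg
      nlinarith)
  rw [integral_exp_neg_norm_sq hs0.le] at mk
  have h1 : (√(1 + 2 * s))⁻¹ ≤ Real.exp (-s + s ^ 2) := by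
    have hlog : s - s ^ 2 ≤ Real.log (√(1 + 2 * s)) := by
      rw [Real.log_sqrt (by positivity)]
      have := Real.le_log_one_add_of_nonneg (x := 2 * s) (by positivity)
      have h2 : 2 * (s - s ^ 2) ≤ 2 * (2 * s) / (2 * s + 2) := by
        rw [le_div_iff₀ (by positivity)]
        nlinarith [pow_pos hs0 3]
      linarith
    rw [show -s + s ^ 2 = -(s - s ^ 2) by ring, Real.exp_neg]
    have := (Real.le_log_iff_exp_le (Real.sqrt_pos.2 (by positivity : 0 < 1 + 2 * s))).1 hlog
    gcongr
  have h2 : (√(1 + 2 * s))⁻¹ ^ m ≤ Real.exp (m * (-s + s ^ 2)) := by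
    rw [Real.exp_nat_mul]
    gcongr
  have h3 := (mul_le_mul_of_nonneg_left (measureReal_mono
    (μ := stdGaussian (EuclideanSpace ℝ (Fin m))) sub)
    (Real.exp_pos (-s * (m - 4 * x))).le).trans (mk.trans h2)
  have h4 : Real.exp (m * (-s + s ^ 2)) =
      Real.exp (-s * (m - 4 * x)) * Real.exp (-(4 : ℕ)) := by
    rw [← Real.exp_add]
    congr 1
    push_cast
    rw [← hx2]
    linear_combination (s * x + 2 - 4) * hsx
  rw [h4] at h3
  have h5 := le_of_mul_le_mul_left h3 (Real.exp_pos _)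
  refine h5.trans ((exp_neg_nat_le 4).trans ?_)
  norm_num

end Width

/-! ### The deterministic lower bound and its finite probabilistic form -/

section LowerBound

variable {n p : ℕ}

/-- Used with x = √n, a = ‖w‖, b = ‖u‖, q the cross width and T the concentration margin. The α²
subtracted in C pays for completing a square that absorbs the cross term in a q, which is the origin
of the factor 1/α. -/
theorem le_of_sq_ge_of_quadratic {x e f y T C α a b q L : ℝ} (he : 0 ≤ e) (hex : e < x)
    (hef : e ≤ f) (hT : 0 ≤ T) (hy : y = e + f / 2 - T) (hy1 : 7.69 ≤ y) (hC : 0 < C)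
    (hxC : x ^ 2 * C = (x - e) ^ 2 - x * f - x ^ 2 * α ^ 2) (hα : 0 < α)
    (hab : a ^ 2 + b ^ 2 = 1) (hq : 0 ≤ q) (hL : 0 ≤ L)
    (hL2 : x ^ 2 - 4 * x * a ^ 2 - 14 * x * (a * b) - 2.4 * x * (a * q) ≤ L ^ 2) :
    x * √C + T - 1.2 / α * q ≤ L := by
  set Y := e + f / 2 with hY
  have hx : 0 < x := he.trans_lt hex
  have hYe : 3 / 2 * e ≤ Y := by linarith
  have hY0 : 0 < Y := by linarith
  have hxJ : x ^ 2 * C + x ^ 2 * α ^ 2 = x ^ 2 - 2 * Y * x + e ^ 2 := by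
    rw [hxC, hY]; ring
  have hJ : 0 < x ^ 2 - 2 * Y * x + e ^ 2 := by
    rw [← hxJ]; positivity
  have heY : e ^ 2 ≤ Y ^ 2 := by gcongr; linarith
  -- The convex quadratic t² − 2Yt + e² is nonpositive at t = e and at t = 3Y/2, yet positive at x >
  -- e.
  have hxY : 3 / 2 * Y ≤ x := by
    by_contra hlt
    push Not at hlt
    have h1 := mul_pos (sub_pos.2 hex) (sub_pos.2 hlt)
    rcases le_total e (Y / 2) with h | h
    · nlinarith [mul_nonneg (sub_nonneg.2 h) (sub_nonneg.2 hex.le), mul_nonneg he hY0.le]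
    · nlinarith [mul_nonneg (sub_nonneg.2 h) (sub_nonneg.2 hlt.le), mul_nonneg he hY0.le]
  set K := x * √C with hK
  have hK0 : 0 ≤ K := by positivity
  have hK2 : K ^ 2 = x ^ 2 * C := by rw [hK, mul_pow, Real.sq_sqrt hC.le]
  have hKx : K ≤ x - Y := by
    refine abs_le_of_sq_le_sq' ?_ (by linarith) |>.2
    have h1 : 0 ≤ x ^ 2 * α ^ 2 := by positivity
    have h2 : (x - Y) ^ 2 = x ^ 2 - 2 * Y * x + Y ^ 2 := by ring
    linarith
  have hR : (K + T) ^ 2 + x ^ 2 * α ^ 2 ≤ (x - y) ^ 2 := by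
    have h1 := mul_le_mul_of_nonneg_right hKx hT
    have h2 : (x - Y) ^ 2 = x ^ 2 - 2 * Y * x + Y ^ 2 := by ring
    have h3 : x - y = x - Y + T := by linarith
    have h4 : (K + T) ^ 2 = K ^ 2 + 2 * (K * T) + T ^ 2 := by ring
    have h5 : (x - Y + T) ^ 2 = (x - Y) ^ 2 + 2 * ((x - Y) * T) + T ^ 2 := by ring
    rw [h3, h4, h5]
    linarith
  -- The top eigenvalue of this form is 2 + √53 ≈ 9.28. It is covered below by 2xy − y² ≥ (4/3)xy,
  -- as (4/3) · 7.69 > 9.3.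
  have hquad : 4 * a ^ 2 + 14 * (a * b) ≤ 9.3 := by
    nlinarith [sq_nonneg (53 * a - 70 * b), sq_nonneg b]
  have hyx : y * y ≤ 2 / 3 * x * y := by
    have : y ≤ 2 / 3 * x := by linarith
    exact mul_le_mul_of_nonneg_right this (by linarith)
  have hA : (K + T) ^ 2 + x ^ 2 * α ^ 2 ≤ x ^ 2 - 4 * x * a ^ 2 - 14 * x * (a * b) := by
    have h1 := mul_le_mul_of_nonneg_left hquad hx.le
    have h2 := mul_le_mul_of_nonneg_left hy1 hx.le
    have h3 : (x - y) ^ 2 = x ^ 2 - 2 * (x * y) + y * y := by ring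
    have h4 : x * (4 * a ^ 2 + 14 * (a * b)) = 4 * x * a ^ 2 + 14 * x * (a * b) := by ring
    linarith
  set R := K + T with hRdef
  set X := 1.2 / α * q with hX
  have hX0 : 0 ≤ X := by positivity
  have hqX : 1.2 * q = α * X := by rw [hX]; field_simp
  -- If R ≤ X the left side is nonpositive. Otherwise x²α² − 2xaαX ≥ −a²X² ≥ −X², and R² − X² ≥ (R −
  -- X)².
  rcases le_total R X with hRX | hRX
  · linarith
  · refine abs_le_of_sq_le_sq' ?_ hL |>.2
    have ha1 : a ^ 2 ≤ 1 := by nlinarith [sq_nonneg b]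
    have h1 : 2.4 * x * (a * q) = 2 * x * a * (α * X) := by rw [← hqX]; ring
    have h2 := mul_nonneg hX0 (sub_nonneg.2 hRX)
    have h3 := sq_nonneg (x * α - a * X)
    have h4 := mul_nonneg (sq_nonneg X) (sub_nonneg.2 ha1)
    have e2 : X * (R - X) = X * R - X ^ 2 := by ring
    have e3 : (x * α - a * X) ^ 2 = x ^ 2 * α ^ 2 - 2 * x * a * (α * X) + a ^ 2 * X ^ 2 := by ring
    have e4 : X ^ 2 * (1 - a ^ 2) = X ^ 2 - a ^ 2 * X ^ 2 := by ring
    have e5 : (R - X) ^ 2 = R ^ 2 - 2 * (X * R) + X ^ 2 := by ring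
    rw [e5]
    linarith

/-- The right-hand side of the transfer inequality. -/
noncomputable def transferBound (n : ℕ) (S : Matrix (Fin p) (Fin p) ℝ) (δ α : ℝ)
    (v : EuclideanSpace ℝ (Fin p)) (u : EuclideanSpace ℝ (Fin n)) : ℝ :=
  √(atpConst n δ α) * ‖WithLp.toLp 2 (sqrtCov S v, u)‖
    - 1.2 * (1 + 1 / α) * (gaussianWidth (sqrtCov S '' l1Ball p) / √(n : ℝ)) * l1norm v
    - 1.2 / α * (gaussianWidth (crossBall u) / √(n : ℝ))

theorem norm_le_of_mem_image_l1Ball (A : EuclideanSpace ℝ (Fin p) →L[ℝ] EuclideanSpace ℝ (Fin p)) :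
    ∀ b ∈ A '' l1Ball p, ‖b‖ ≤ ‖A‖ := by
  rintro _ ⟨x, hx, rfl⟩
  refine (A.le_opNorm x).trans (mul_le_of_le_one_right (norm_nonneg _) ?_)
  exact (norm_le_l1norm x).trans hx

theorem zero_mem_image_l1Ball (A : EuclideanSpace ℝ (Fin p) →L[ℝ] EuclideanSpace ℝ (Fin p)) :
    0 ∈ A '' l1Ball p := ⟨0, zero_mem_l1Ball, map_zero A⟩

theorem neg_inner_le_l1norm_mul_suppFun
    (A : EuclideanSpace ℝ (Fin p) →L[ℝ] EuclideanSpace ℝ (Fin p)) (v h : EuclideanSpace ℝ (Fin p)) :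
    -inner ℝ (A v) h ≤ l1norm v * suppFun (A '' l1Ball p) h := by
  rcases (l1norm_nonneg v).eq_or_lt with h0 | hpos
  · rw [eq_zero_of_l1norm_eq_zero h0.symm]
    simp [l1norm]
  · have hmem : A (-((l1norm v)⁻¹ • v)) ∈ A '' l1Ball p := by
      refine ⟨_, ?_, rfl⟩
      rw [mem_l1Ball, l1norm_neg, l1norm_smul, abs_of_pos (inv_pos.2 hpos),
        inv_mul_cancel₀ hpos.ne']
    have h1 := inner_le_suppFun (norm_le_of_mem_image_l1Ball A) hmem h
    rw [map_neg, map_smul, inner_neg_left, real_inner_smul_left, ← mul_neg,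
      inv_mul_le_iff₀ hpos] at h1
    exact h1

variable {S : Matrix (Fin p) (Fin p) ℝ} {δ α : ℝ}

/-- Positivity of C gives α² < 1. Consequently 1.2(1 + 1/α) ≥ 2.4, the level at which Markov's
inequality is applied to h. -/
theorem alpha_lt_one (hn : 100 ≤ n) (htp : 0 < tpConst n δ) (hC : 0 < atpConst n δ α) : α < 1 := by
  have hx : 0 < √(n : ℝ) := Real.sqrt_pos.2 (by exact_mod_cast (by omega : 0 < n))
  have h1 : tpConst n δ ≤ 1 := by
    have : 0 ≤ (4.3 + √(2 * Real.log (9 / δ))) / √(n : ℝ) := by positivity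
    unfold tpConst
    linarith
  have h2 : 0 ≤ √(2 / (n : ℝ)) * (4.8 + √(Real.log (81 / δ))) := by positivity
  unfold atpConst at hC
  nlinarith

/-- The decoupled process satisfies the shifted bound whenever `g` and `h` are typical. -/
theorem transferBound_add_le (hδ0 : 0 < δ) (hδ : δ ≤ 1 / 7) (hn : 100 ≤ n) (hα : 0 < α)
    (htp : 0 < tpConst n δ) (hC : 0 < atpConst n δ α)
    {v : EuclideanSpace ℝ (Fin p)} {u : EuclideanSpace ℝ (Fin n)}
    (hvu : ‖sqrtCov S v‖ ^ 2 + ‖u‖ ^ 2 = 1)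
    {g : EuclideanSpace ℝ (Fin n)} {h : EuclideanSpace ℝ (Fin p)}
    (hg : n - 4 * √(n : ℝ) ≤ ‖g‖ ^ 2)
    (hgu : -inner ℝ u g ≤ 1.2 * gaussianWidth (crossBall u) + 7 * ‖u‖)
    (hh : suppFun (sqrtCov S '' l1Ball p) h ≤ 2.4 * gaussianWidth (sqrtCov S '' l1Ball p)) :
    √(n : ℝ) * transferBound n S δ α v u + 2 * √(Real.log (9 / δ)) ≤
      ‖‖sqrtCov S v‖ • g + √(n : ℝ) • u‖ + inner ℝ (sqrtCov S v) h := by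
  have hn' : (0 : ℝ) < n := by exact_mod_cast (by omega : 0 < n)
  set x := √(n : ℝ) with hx
  have hx0 : 0 < x := Real.sqrt_pos.2 hn'
  have hx2 : x ^ 2 = n := Real.sq_sqrt hn'.le
  set r := √(2 : ℝ) with hr
  have hr2 : r ^ 2 = 2 := Real.sq_sqrt (by norm_num)
  have hr0 : 0 ≤ r := Real.sqrt_nonneg _
  have hr1 : 1.414 ≤ r := Real.le_sqrt_of_sq_le (by norm_num)
  set s := √(Real.log (9 / δ)) with hs
  have hs0 : 0 ≤ s := Real.sqrt_nonneg _
  set s' := √(Real.log (81 / δ)) with hs'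
  have hss : s ≤ s' := by
    refine Real.sqrt_le_sqrt (Real.log_le_log (by positivity) ?_)
    gcongr
    norm_num
  have hl : √(2 * Real.log (9 / δ)) = r * s := Real.sqrt_mul (by norm_num) _
  have htp' : tpConst n δ = 1 - (4.3 + r * s) / x := by unfold tpConst; rw [hl]
  have hnorm : ‖WithLp.toLp 2 (sqrtCov S v, u)‖ = 1 := by
    rw [WithLp.prod_norm_eq_of_L2]
    simp [hvu]
  set a := ‖sqrtCov S v‖
  set b := ‖u‖
  set q := gaussianWidth (crossBall u) with hq
  have hq0 : 0 ≤ q := gaussianWidth_crossBall_nonneg u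
  set m := gaussianWidth (sqrtCov S '' l1Ball p) with hm
  have hm0 : 0 ≤ m := gaussianWidth_nonneg (norm_le_of_mem_image_l1Ball _) (zero_mem_image_l1Ball _)
  have hα1 := alpha_lt_one hn htp hC
  have hmv : 0 ≤ m * l1norm v := mul_nonneg hm0 (l1norm_nonneg v)
  have hhv : -(1.2 * (1 + 1 / α) * (m * l1norm v)) ≤ inner ℝ (sqrtCov S v) h := by
    have h1 := neg_inner_le_l1norm_mul_suppFun (sqrtCov S) v h
    have h2 := mul_le_mul_of_nonneg_left hh (l1norm_nonneg v)
    have h3 : 1 ≤ 1 / α := by rw [le_div_iff₀ hα]; linarith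
    have h4 := mul_le_mul_of_nonneg_right h3 hmv
    nlinarith
  -- Expanding the square, 4xa² comes from the chi-square bound, and 14 = 2 · 7 and 2.4 = 2 · 1.2
  -- from the peeling bound on ⟨u, g⟩.
  have hL2 : x ^ 2 - 4 * x * a ^ 2 - 14 * x * (a * b) - 2.4 * x * (a * q) ≤
      ‖a • g + x • u‖ ^ 2 := by
    rw [norm_add_sq_real, norm_smul, norm_smul, real_inner_smul_left, real_inner_smul_right,
      mul_pow, mul_pow, Real.norm_eq_abs, Real.norm_eq_abs, sq_abs, sq_abs, real_inner_comm]
    have h1 := mul_le_mul_of_nonneg_left hg (sq_nonneg a)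
    have h2 := mul_le_mul_of_nonneg_left hgu
      (mul_nonneg hx0.le (norm_nonneg (sqrtCov S v)))
    have hb : b ^ 2 = 1 - a ^ 2 := by linarith
    rw [← hx2] at h1
    rw [show ‖u‖ ^ 2 = b ^ 2 from rfl, hb]
    change x * a * _ ≤ x * a * _ at h2
    nlinarith
  have key := le_of_sq_ge_of_quadratic (x := x) (e := 4.3 + r * s) (f := r * (4.8 + s'))
    (y := 4.3 + r * s + r * (4.8 + s') / 2 - 2 * s) (T := 2 * s) (C := atpConst n δ α) (α := α)
    (a := a) (b := b) (q := q) (L := ‖a • g + x • u‖) (by positivity) ?_ ?_ (by positivity) rfl ?_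
    hC ?_ hα hvu hq0 (norm_nonneg _) hL2
  · unfold transferBound
    rw [hnorm, mul_one]
    have e1 : x * (√(atpConst n δ α) - 1.2 * (1 + 1 / α) * (m / x) * l1norm v -
        1.2 / α * (q / x)) = x * √(atpConst n δ α) - 1.2 * (1 + 1 / α) * (m * l1norm v) -
        1.2 / α * q := by
      field_simp
    rw [e1]
    linarith
  · rw [htp', sub_pos, div_lt_one hx0] at htp
    exact htp
  · linarith [mul_le_mul_of_nonneg_left hss hr0]
  -- As (3/2)√2 > 2 and s ≤ s', the terms √2 (s + s'/2) absorb the margin 2s, leaving y ≥ 4.3 +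
  -- 2.4√2 > 7.69.
  · linarith [mul_le_mul_of_nonneg_left hss hr0, mul_le_mul_of_nonneg_right hr1 hs0]
  · unfold atpConst
    rw [htp', Real.sqrt_div (by norm_num), ← hr, ← hx, ← hs']
    field_simp

/-- Finite version of the transfer inequality for normalized pairs. -/
theorem measureReal_rowAct_lt_le {ι : Type*} [Fintype ι] (hδ0 : 0 < δ) (hδ : δ ≤ 1 / 7)
    (hn : 100 ≤ n) (hα : 0 < α) (htp : 0 < tpConst n δ) (hC : 0 < atpConst n δ α)
    (v : ι → EuclideanSpace ℝ (Fin p)) (u : ι → EuclideanSpace ℝ (Fin n))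
    (hvu : ∀ i, ‖sqrtCov S (v i)‖ ^ 2 + ‖u i‖ ^ 2 = 1) :
    (stdGaussian (RowSpace n p)).real {G | ∃ i,
      ‖rowAct (sqrtCov S (v i)) G + √(n : ℝ) • u i‖ < √(n : ℝ) * transferBound n S δ α (v i) (u i)}
      ≤ 2 * δ := by
  set T := 2 * √(Real.log (9 / δ)) with hT
  set c : ι → ℝ := fun i => √(n : ℝ) * transferBound n S δ α (v i) (u i) + T with hc
  have hlog : 0 ≤ Real.log (9 / δ) := Real.log_nonneg (by rw [le_div_iff₀ hδ0]; linarith)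
  set B := sqrtCov S '' l1Ball p
  set γn := stdGaussian (EuclideanSpace ℝ (Fin n))
  set γp := stdGaussian (EuclideanSpace ℝ (Fin p))
  set E1 : Set (EuclideanSpace ℝ (Fin n)) := {g | ‖g‖ ^ 2 < n - 4 * √(n : ℝ)}
  set E2 : Set (EuclideanSpace ℝ (Fin n)) :=
    {g | ∃ i, 1.2 * gaussianWidth (crossBall (u i)) + 7 * ‖u i‖ < -inner ℝ (u i) g}
  set E3 : Set (EuclideanSpace ℝ (Fin p)) := {h | 2.4 * gaussianWidth B < suppFun B h}
  -- The sum 0.019 + 0.017 + 1/2.4 is below 17/36; doubled by Gordon's comparison, it leaves a good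
  -- probability of at least 1/18.
  have bad : (γn.prod γp).real {q | ∃ i, ‖‖sqrtCov S (v i)‖ • q.1 + √(n : ℝ) • u i‖ +
      inner ℝ (sqrtCov S (v i)) q.2 < c i} ≤ 17 / 36 := by
    have sub : {q : EuclideanSpace ℝ (Fin n) × EuclideanSpace ℝ (Fin p) | ∃ i,
        ‖‖sqrtCov S (v i)‖ • q.1 + √(n : ℝ) • u i‖ + inner ℝ (sqrtCov S (v i)) q.2 < c i} ⊆
        (E1 ∪ E2) ×ˢ Set.univ ∪ Set.univ ×ˢ E3 := by
      rintro ⟨g, h⟩ ⟨i, hi⟩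
      by_contra hnot
      have h1 : g ∉ E1 := fun hg => hnot (Or.inl ⟨Or.inl hg, trivial⟩)
      have h2 : g ∉ E2 := fun hg => hnot (Or.inl ⟨Or.inr hg, trivial⟩)
      have h3 : h ∉ E3 := fun hg => hnot (Or.inr ⟨trivial, hg⟩)
      have h2' : -inner ℝ (u i) g ≤ 1.2 * gaussianWidth (crossBall (u i)) + 7 * ‖u i‖ :=
        le_of_not_gt fun hlt => h2 ⟨i, hlt⟩
      have := transferBound_add_le hδ0 hδ hn hα htp hC (hvu i) (not_lt.1 h1) h2' (not_lt.1 h3)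
      exact absurd hi (not_lt.2 this)
    have p1 : γn.real E1 ≤ 0.019 := measureReal_norm_sq_lt_le (by omega)
    have p2 : γn.real E2 ≤ 0.017 := measureReal_peeling_le u
    have p3 : γp.real E3 ≤ 1 / 2.4 := measureReal_lt_suppFun_le (norm_le_of_mem_image_l1Ball _)
      (zero_mem_image_l1Ball _) (by norm_num)
    have q1 := measureReal_mono (μ := γn.prod γp) sub
    have q2 := measureReal_union_le (μ := γn.prod γp) ((E1 ∪ E2) ×ˢ Set.univ) (Set.univ ×ˢ E3)
    have q3 := measureReal_union_le (μ := γn) E1 E2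
    rw [measureReal_prod_prod, measureReal_prod_prod, probReal_univ, probReal_univ, mul_one,
      one_mul] at q2
    norm_num at p3 p1 p2
    linarith
  have gor := rowAct_lt_le_two_mul (n := n) (fun i => sqrtCov S (v i))
    (fun i => √(n : ℝ) • u i) c
  have mA : MeasurableSet {G : RowSpace n p | ∃ i,
      ‖rowAct (sqrtCov S (v i)) G + √(n : ℝ) • u i‖ < c i} := by
    rw [Set.ofPred_exists]
    exact MeasurableSet.iUnion fun i => measurableSet_lt (by fun_prop) measurable_const
  have hcompl := probReal_compl_eq_one_sub (μ := stdGaussian (RowSpace n p)) mA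
  have heq : {G : RowSpace n p | ∃ i,
      ‖rowAct (sqrtCov S (v i)) G + √(n : ℝ) • u i‖ < c i}ᶜ =
      {G | ∀ i, c i ≤ ‖rowAct (sqrtCov S (v i)) G + √(n : ℝ) • u i‖} := by
    ext G
    simp
  rw [heq] at hcompl
  -- The choice t = T/2 minimizes t² − tT, with value −log(9/δ); dividing δ/9 by 1/18 yields 2δ.
  have conc := rowAct_concentration (n := n) (w := fun i => sqrtCov S (v i)) (fun i => by
    have := hvu i
    refine abs_le_of_sq_le_sq' ?_ zero_le_one |>.2
    nlinarith [sq_nonneg ‖u i‖]) (fun i => √(n : ℝ) • u i) c T (t := T / 2) (by positivity)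
  have hexp : Real.exp ((T / 2) ^ 2 - T / 2 * T) = δ / 9 := by
    have : (T / 2) ^ 2 - T / 2 * T = -Real.log (9 / δ) := by
      rw [hT, mul_div_cancel_left₀ _ (two_ne_zero' ℝ)]
      nlinarith [Real.sq_sqrt hlog]
    rw [this, Real.exp_neg, Real.exp_log (by positivity), inv_div]
  rw [hexp] at conc
  simp only [hc, add_sub_cancel_right] at conc
  set P0 := (stdGaussian (RowSpace n p)).real {G | ∃ i,
      ‖rowAct (sqrtCov S (v i)) G + √(n : ℝ) • u i‖ < √(n : ℝ) * transferBound n S δ α (v i) (u i)}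
  have hP0 : 0 ≤ P0 := measureReal_nonneg
  have hgood : 1 / 18 ≤ (stdGaussian (RowSpace n p)).real
      {G | ∀ i, c i ≤ ‖rowAct (sqrtCov S (v i)) G + √(n : ℝ) • u i‖} := by
    rw [hcompl]
    linarith
  have := mul_le_mul_of_nonneg_left hgood hP0
  change P0 * (stdGaussian (RowSpace n p)).real
      {G | ∀ i, c i ≤ ‖rowAct (sqrtCov S (v i)) G + √(n : ℝ) • u i‖} ≤ δ / 9 at conc
  linarith

end LowerBound

/-! ### From finite normalized families to all vectors and to the design Z -/

section Transfer

variable {n p : ℕ} {S : Matrix (Fin p) (Fin p) ℝ} {δ α : ℝ}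

theorem gaussianWidth_crossBall_le (u : EuclideanSpace ℝ (Fin n)) :
    gaussianWidth (crossBall u) ≤ ‖u‖ * gaussianWidth (l2Ball n) := by
  rw [← gaussianWidth_smul (norm_nonneg u)]
  exact gaussianWidth_mono (fun b hb => (mem_smul_l2Ball (norm_nonneg u)).1 hb)
    (zero_mem_crossBall u) Set.inter_subset_right

/-- Upper semicontinuity of the width of `crossBall`. -/
theorem exists_continuous_majorant (u : EuclideanSpace ℝ (Fin n)) :
    ∃ ψ : EuclideanSpace ℝ (Fin n) → ℝ, Continuous ψ ∧
      (∀ y, gaussianWidth (crossBall y) ≤ ψ y) ∧ ψ u ≤ gaussianWidth (crossBall u) := by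
  rcases eq_or_ne u 0 with rfl | hu
  · refine ⟨fun y => ‖y‖ * gaussianWidth (l2Ball n), by fun_prop, gaussianWidth_crossBall_le, ?_⟩
    simpa using gaussianWidth_crossBall_nonneg (0 : EuclideanSpace ℝ (Fin n))
  · have h2 : 0 < ‖u‖ := norm_pos_iff.2 hu
    have h1 : 0 < l1norm u := h2.trans_le (norm_le_l1norm u)
    have hc := continuous_l1norm (m := n)
    -- The cross ball of y lies in the dilate of that of u by the larger of the two norm ratios,
    -- which equals 1 at y = u.
    refine ⟨fun y => max (l1norm y / l1norm u) (‖y‖ / ‖u‖) * gaussianWidth (crossBall u),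
      by fun_prop, fun y => ?_, by simp [h1.ne', h2.ne']⟩
    have hw := gaussianWidth_crossBall_nonneg u
    rcases eq_or_ne y 0 with rfl | hy
    · refine (gaussianWidth_crossBall_le 0).trans ?_
      rw [norm_zero, zero_mul]
      exact mul_nonneg (le_max_of_le_right (by simp)) hw
    · set ρ := max (l1norm y / l1norm u) (‖y‖ / ‖u‖) with hρ
      have hρ0 : 0 < ρ := lt_max_of_lt_right (div_pos (norm_pos_iff.2 hy) h2)
      change _ ≤ ρ * gaussianWidth (crossBall u)
      rw [← gaussianWidth_crossBall_smul hρ0]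
      refine gaussianWidth_mono (norm_le_of_mem_crossBall _) (zero_mem_crossBall y) fun x hx => ?_
      rw [mem_crossBall] at hx ⊢
      rw [l1norm_smul, norm_smul, abs_of_pos hρ0, Real.norm_of_nonneg hρ0.le]
      exact ⟨hx.1.trans ((div_le_iff₀ h1).1 (le_max_left _ _)),
        hx.2.trans ((div_le_iff₀ h2).1 (le_max_right _ _))⟩

theorem gaussianWidth_image_l1Ball_nonneg
    (A : EuclideanSpace ℝ (Fin p) →L[ℝ] EuclideanSpace ℝ (Fin p)) :
    0 ≤ gaussianWidth (A '' l1Ball p) :=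
  gaussianWidth_nonneg (norm_le_of_mem_image_l1Ball A) (zero_mem_image_l1Ball A)

theorem transferBound_smul {c : ℝ} (hc : 0 < c) (v : EuclideanSpace ℝ (Fin p))
    (u : EuclideanSpace ℝ (Fin n)) :
    transferBound n S δ α (c • v) (c • u) = c * transferBound n S δ α v u := by
  have h : WithLp.toLp 2 (sqrtCov S (c • v), c • u) = c • WithLp.toLp 2 (sqrtCov S v, u) := by
    rw [map_smul]
    rfl
  rw [transferBound, transferBound, h, norm_smul, l1norm_smul, gaussianWidth_crossBall_smul hc,
    Real.norm_of_nonneg hc.le, abs_of_pos hc]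
  ring

/-- A degenerate pair cannot violate the inequality, so it may be dropped before normalizing. -/
theorem transferBound_nonpos (hα : 0 < α) {v : EuclideanSpace ℝ (Fin p)}
    {u : EuclideanSpace ℝ (Fin n)} (h : ‖WithLp.toLp 2 (sqrtCov S v, u)‖ = 0) :
    transferBound n S δ α v u ≤ 0 := by
  have h1 := gaussianWidth_image_l1Ball_nonneg (sqrtCov S)
  have h2 := gaussianWidth_crossBall_nonneg u
  have h3 := l1norm_nonneg v
  have h4 : 0 ≤ 1.2 * (1 + 1 / α) * (gaussianWidth (sqrtCov S '' l1Ball p) / √(n : ℝ)) *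
    l1norm v := by positivity
  have h5 : 0 ≤ 1.2 / α * (gaussianWidth (crossBall u) / √(n : ℝ)) := by positivity
  rw [transferBound, h, mul_zero]
  linarith

/-- Homogeneity removes the normalization in `measureReal_rowAct_lt_le`. -/
theorem measureReal_rowAct_lt_le_of_fintype {ι : Type*} [Fintype ι] (hδ0 : 0 < δ) (hδ : δ ≤ 1 / 7)
    (hn : 100 ≤ n) (hα : 0 < α) (htp : 0 < tpConst n δ) (hC : 0 < atpConst n δ α)
    (v : ι → EuclideanSpace ℝ (Fin p)) (u : ι → EuclideanSpace ℝ (Fin n)) :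
    (stdGaussian (RowSpace n p)).real {G | ∃ i,
      ‖rowAct (sqrtCov S (v i)) G + √(n : ℝ) • u i‖ < √(n : ℝ) * transferBound n S δ α (v i) (u i)}
      ≤ 2 * δ := by
  classical
  let r : ι → ℝ := fun i => ‖WithLp.toLp 2 (sqrtCov S (v i), u i)‖
  have hr : ∀ i : {i // r i ≠ 0}, 0 < (r i)⁻¹ := fun i =>
    inv_pos.2 ((norm_nonneg _).lt_of_ne' i.2)
  refine le_trans (measureReal_mono ?_) (measureReal_rowAct_lt_le (ι := {i // r i ≠ 0}) (S := S)
    hδ0 hδ hn hα htp hC (fun i => (r i)⁻¹ • v i) (fun i => (r i)⁻¹ • u i) fun i => ?_)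
  · rintro G ⟨i, hi⟩
    have hri : r i ≠ 0 := fun h0 => by
      have := mul_nonpos_of_nonneg_of_nonpos (Real.sqrt_nonneg (n : ℝ))
        (transferBound_nonpos (δ := δ) hα h0)
      exact absurd (hi.trans_le this) (norm_nonneg _).not_gt
    refine ⟨⟨i, hri⟩, ?_⟩
    have hpos := hr ⟨i, hri⟩
    have e : rowAct (sqrtCov S ((r i)⁻¹ • v i)) G + √(n : ℝ) • (r i)⁻¹ • u i =
        (r i)⁻¹ • (rowAct (sqrtCov S (v i)) G + √(n : ℝ) • u i) := by
      ext k
      simp only [PiLp.add_apply, PiLp.smul_apply, rowAct_apply, map_smul, real_inner_smul_left,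
        smul_eq_mul]
      ring
    change ‖rowAct (sqrtCov S ((r i)⁻¹ • v i)) G + √(n : ℝ) • (r i)⁻¹ • u i‖ < _
    rw [e, norm_smul, Real.norm_of_nonneg hpos.le, transferBound_smul hpos, mul_left_comm]
    exact mul_lt_mul_of_pos_left hi hpos
  · have h2 : r i ^ 2 = ‖sqrtCov S (v i)‖ ^ 2 + ‖u i‖ ^ 2 := by
      exact WithLp.prod_norm_sq_eq_of_L2 _
    have h3 : r i ^ 2 ≠ 0 := pow_ne_zero 2 i.2
    rw [map_smul, norm_smul, norm_smul, mul_pow, mul_pow, ← mul_add, ← h2, norm_inv, norm_norm,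
      inv_pow, inv_mul_cancel₀ h3]

/-- The transfer inequality along a sequence of pairs. -/
theorem measure_rowAct_lt_le_of_seq (hδ0 : 0 < δ) (hδ : δ ≤ 1 / 7)
    (hn : 100 ≤ n) (hα : 0 < α) (htp : 0 < tpConst n δ) (hC : 0 < atpConst n δ α)
    (d : ℕ → EuclideanSpace ℝ (Fin p) × EuclideanSpace ℝ (Fin n)) :
    (stdGaussian (RowSpace n p)).real {G | ∃ i, ‖rowAct (sqrtCov S (d i).1) G + √(n : ℝ) • (d i).2‖
      < √(n : ℝ) * transferBound n S δ α (d i).1 (d i).2} ≤ 2 * δ := by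
  rw [Set.ofPred_exists]
  refine ENNReal.toReal_le_of_le_ofReal (by positivity) ?_
  -- The events for the pairs of index at most m increase to the whole event, and each is a family
  -- of m + 1 pairs obeying the same bound.
  rw [measure_iUnion_eq_iSup_accumulate]
  refine iSup_le fun m => ?_
  have h := measureReal_rowAct_lt_le_of_fintype (S := S) hδ0 hδ hn hα htp hC
    (fun i : Fin (m + 1) => (d i).1) (fun i => (d i).2)
  rw [← ENNReal.ofReal_toReal (measure_ne_top (stdGaussian (RowSpace n p)) _)]
  refine ENNReal.ofReal_le_ofReal (le_trans (measureReal_mono ?_ (measure_ne_top _ _)) h)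
  intro G hG
  obtain ⟨i, hi, hG⟩ := Set.mem_accumulate.1 hG
  exact ⟨⟨i, Nat.lt_succ_of_le hi⟩, hG⟩

theorem stdGaussian_rowSpace : stdGaussian (RowSpace n p) =
    (Measure.pi fun _ : Fin n => stdGaussian (EuclideanSpace ℝ (Fin p))).map (WithLp.toLp 2) := by
  apply Measure.ext_of_charFun
  ext t
  simp_rw [charFun_pi, charFun_stdGaussian, ← Complex.exp_sum, ← Complex.ofReal_pow,
    PiLp.norm_sq_eq_of_L2]
  simp [Finset.sum_div, neg_div]

open scoped MatrixOrder Matrix.Norms.L2Operator in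
-- Self-adjointness moves the square root from the rows of G onto the vector v.
theorem inner_sqrtCov_comm (x y : EuclideanSpace ℝ (Fin p)) :
    inner ℝ x (sqrtCov S y) = inner ℝ (sqrtCov S x) y := by
  have h : IsSelfAdjoint (sqrtCov S) := (CFC.sqrt_nonneg S).isSelfAdjoint.map _
  exact ((ContinuousLinearMap.isSelfAdjoint_iff_isSymmetric.1 h) x y).symm

/-- The joint law of the rows of a Gaussian design. -/
theorem IsGaussianDesign.map_rows {Ω : Type*} [MeasurableSpace Ω] {P : Measure Ω}
    {Z : Ω → Matrix (Fin n) (Fin p) ℝ} (hZ : IsGaussianDesign Z S P) :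
    P.map (fun ω i => WithLp.toLp 2 (Z ω i)) =
      (stdGaussian (RowSpace n p)).map fun G i => sqrtCov S (G i) := by
  rw [hZ.indep.map_fun_eq_pi_map fun i => (hZ.law i).aemeasurable, stdGaussian_rowSpace,
    Measure.map_map (by fun_prop) (by fun_prop)]
  simp_rw [fun i => (hZ.law i).map_eq]
  have : multivariateGaussian 0 S = (stdGaussian (EuclideanSpace ℝ (Fin p))).map (sqrtCov S) := by
    simp [multivariateGaussian, sqrtCov]
  rw [this, ← Measure.pi_map_pi (fun _ => by fun_prop)]
  rfl

theorem sqrt_smul_normDesign (hn : 0 < n) (M : Matrix (Fin n) (Fin p) ℝ)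
    (v : EuclideanSpace ℝ (Fin p)) (u : EuclideanSpace ℝ (Fin n)) :
    √(n : ℝ) • (normDesign M v + u) =
      rowAct v (WithLp.toLp 2 fun i => WithLp.toLp 2 (M i)) + √(n : ℝ) • u := by
  have hx : √(n : ℝ) ≠ 0 := (Real.sqrt_pos.2 (by exact_mod_cast hn)).ne'
  rw [smul_add]
  congr 1
  ext k
  rw [rowAct_apply, PiLp.smul_apply, normDesign, Matrix.smul_mulVec]
  simp [hx, Matrix.mulVec, dotProduct, PiLp.inner_apply]

theorem continuous_normDesign (M : Matrix (Fin n) (Fin p) ℝ) : Continuous (normDesign M) :=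
  (PiLp.continuous_toLp 2 _).comp
    (Continuous.matrix_mulVec continuous_const (PiLp.continuous_ofLp 2 _))

/-- The transfer inequality extends from a dense set of pairs to all pairs. -/
theorem transferBound_le_of_denseRange (hα : 0 < α) {M : Matrix (Fin n) (Fin p) ℝ}
    {d : ℕ → EuclideanSpace ℝ (Fin p) × EuclideanSpace ℝ (Fin n)} (hd : DenseRange d)
    (h : ∀ i, transferBound n S δ α (d i).1 (d i).2 ≤ ‖normDesign M (d i).1 + (d i).2‖)
    (v : EuclideanSpace ℝ (Fin p)) (u : EuclideanSpace ℝ (Fin n)) :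
    transferBound n S δ α v u ≤ ‖normDesign M v + u‖ := by
  -- The width enters with a minus sign, so replacing it by ψ weakens the inequality on the dense
  -- set, loses nothing at u, and turns it into a closed condition.
  obtain ⟨ψ, hψc, hψ, hψu⟩ := exists_continuous_majorant u
  have hcl1 := continuous_l1norm (m := p)
  have hM := continuous_normDesign M
  have mono : ∀ {x y : ℝ}, x ≤ y → 1.2 / α * (x / √(n : ℝ)) ≤ 1.2 / α * (y / √(n : ℝ)) :=
    fun h => by gcongr
  let f : EuclideanSpace ℝ (Fin p) × EuclideanSpace ℝ (Fin n) → ℝ := fun q =>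
    √(atpConst n δ α) * ‖WithLp.toLp 2 (sqrtCov S q.1, q.2)‖
      - 1.2 * (1 + 1 / α) * (gaussianWidth (sqrtCov S '' l1Ball p) / √(n : ℝ)) * l1norm q.1
      - 1.2 / α * (ψ q.2 / √(n : ℝ))
  have hf : Continuous f := by fun_prop
  have hcl : IsClosed {q | f q ≤ ‖normDesign M q.1 + q.2‖} := isClosed_le hf (by fun_prop)
  have hall : ∀ q, f q ≤ ‖normDesign M q.1 + q.2‖ := by
    have hsub : closure (Set.range d) ⊆ {q | f q ≤ ‖normDesign M q.1 + q.2‖} := by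
      refine hcl.closure_subset_iff.2 ?_
      rintro _ ⟨i, rfl⟩
      exact (sub_le_sub_left (mono (hψ (d i).2)) _).trans (h i)
    exact fun q => hsub (hd q)
  exact (sub_le_sub_left (mono hψu) _).trans (hall (v, u))

end Transfer

theorem mainTheorem8 {Ω : Type*} [MeasurableSpace Ω] (P : Measure Ω) [IsProbabilityMeasure P]
    (n p : ℕ) (S : Matrix (Fin p) (Fin p) ℝ) (hS : S.PosSemidef)
    (Z : Ω → Matrix (Fin n) (Fin p) ℝ) (hZ : IsGaussianDesign Z S P)
    (δ α : ℝ) (hδ0 : 0 < δ) (hδ : δ ≤ 1 / 7) (hn : 100 ≤ n) (hα : 0 < α)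
    (htp : 0 < tpConst n δ) (hC : 0 < atpConst n δ α) :
    1 - 2 * δ ≤ P.real {ω | ∀ (v : EuclideanSpace ℝ (Fin p)) (u : EuclideanSpace ℝ (Fin n)),
      √(atpConst n δ α) * ‖WithLp.toLp 2 (sqrtCov S v, u)‖
          - 1.2 * (1 + 1 / α) * (gaussianWidth (sqrtCov S '' l1Ball p) / √(n : ℝ)) * l1norm v
          - 1.2 / α * (gaussianWidth (l1norm u • l1Ball n ∩ ‖u‖ • l2Ball n) / √(n : ℝ))
        ≤ ‖normDesign (Z ω) v + u‖} := by
  set d := TopologicalSpace.denseSeq (EuclideanSpace ℝ (Fin p) × EuclideanSpace ℝ (Fin n))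
  set X : Ω → Fin n → EuclideanSpace ℝ (Fin p) := fun ω i => WithLp.toLp 2 (Z ω i)
  set A : Set (Fin n → EuclideanSpace ℝ (Fin p)) := {x | ∃ i,
    ‖rowAct (d i).1 (WithLp.toLp 2 x) + √(n : ℝ) • (d i).2‖ <
      √(n : ℝ) * transferBound n S δ α (d i).1 (d i).2}
  have mA : MeasurableSet A := by
    simp only [A, Set.ofPred_exists]
    exact MeasurableSet.iUnion fun i => measurableSet_lt (by fun_prop) measurable_const
  have hX : AEMeasurable X P := aemeasurable_pi_lambda _ fun i => (hZ.law i).aemeasurable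
  have hA : P.real (X ⁻¹' A) ≤ 2 * δ := by
    rw [← map_measureReal_apply_of_aemeasurable hX mA, hZ.map_rows,
      map_measureReal_apply (by fun_prop) mA]
    refine le_trans (measureReal_mono ?_) (measure_rowAct_lt_le_of_seq (S := S) hδ0 hδ hn hα htp hC d)
    rintro G ⟨i, hi⟩
    refine ⟨i, ?_⟩
    have e : rowAct (d i).1 (WithLp.toLp 2 fun k => sqrtCov S (G k)) =
        rowAct (sqrtCov S (d i).1) G := by
      ext k
      exact inner_sqrtCov_comm _ _
    rw [← e]
    exact hi
  have hn' : (0 : ℝ) < n := by exact_mod_cast (by omega : 0 < n)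
  have hx : 0 < √(n : ℝ) := Real.sqrt_pos.2 hn'
  -- Subadditivity suffices here, so the preimage under the merely almost everywhere measurable X
  -- need not be measurable.
  have hAc : 1 - 2 * δ ≤ P.real (X ⁻¹' A)ᶜ := by
    have h1 := measureReal_union_le (μ := P) (X ⁻¹' A) (X ⁻¹' A)ᶜ
    rw [Set.union_compl_self, probReal_univ] at h1
    linarith
  refine hAc.trans (measureReal_mono ?_)
  intro ω hω v u
  have hd : ∀ i, transferBound n S δ α (d i).1 (d i).2 ≤
      ‖normDesign (Z ω) (d i).1 + (d i).2‖ := fun i => by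
    have h1 := not_lt.1 fun h => hω ⟨i, h⟩
    rw [← sqrt_smul_normDesign (by omega), norm_smul, Real.norm_of_nonneg hx.le] at h1
    exact le_of_mul_le_mul_left h1 hx
  exact transferBound_le_of_denseRange hα (TopologicalSpace.denseRange_denseSeq _) hd v u
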